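/- For $\gamma=\begin{pmatrix}a&b\\c&d\end{pmatrix}\in\mathrm{SL}_2(\mathbb Z)$, $\tau$ in the upper half-plane $\mathcal H$, an integer $k\ge0$ and $f:\mathcal H\to\mathbb C$ put $$J(\gamma,\tau)=\Big(\frac cd\Big)\sqrt{c\tau+d},\qquad (f|_{k/2}\gamma)(\tau)=\frac{f(\gamma\tau)}{J(\gamma,\tau)^{k}},$$ where $(\frac cd)$ is the Kronecker symbol and $\sqrt z$ is the principal square root, with argument in $(-\frac\pi2,\frac\pi2]$ (so $J^{k}=(c\tau+d)^{k/2}$ for even $k$). Let $\Gamma(4)\subset\mathrm{SL}_2(\mathbb Z)$ be the principal congruence subgroup of level $4$. Let $\mathcal M(\Gamma(4))_{k/2}$ be the space of holomorphic functions $f$ on $\mathcal H$ such that $f|_{k/2}\gamma=f$ for all $\gamma\in\Gamma(4)$ and, for every $\alpha\in\mathrm{SL}_2(\mathbb Z)$, $(f|_{k/2}\alpha)(\tau)$ is bounded as $\operatorname{Im}\tau\to\infty$. Let $\mathcal S(\Gamma(4))_{k/2}\subset\mathcal M(\Gamma(4))_{k/2}$ be the subspace of those $f$ with $(f|_{k/2}\alpha)(\tau)\to0$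 as $\operatorname{Im}\tau\to\infty$ for every $\alpha\in\mathrm{SL}_2(\mathbb Z)$. Put $$\mathcal M(\Gamma(4))_{\frac12\mathbb N}=\bigoplus_{k\ge0}\mathcal M(\Gamma(4))_{k/2},\qquad \mathcal S(\Gamma(4))_{\frac12\mathbb N}=\bigoplus_{k\ge0}\mathcal S(\Gamma(4))_{k/2},$$ a graded $\mathbb C$-algebra and an ideal of it. With $q=e^{2\pi i\tau}$ put $$\theta(\tau)=\sum_{n\in\mathbb Z}q^{n^2},\quad \eta(\tau)=q^{1/24}\prod_{n\ge1}(1-q^n),\quad \eta^\flat(\tau)=\frac{\eta(\tau/2)^2}{\eta(\tau)},\quad \eta^\sharp(\tau)=\frac{\eta(2\tau)^2}{\eta(\tau)}.$$ Theorem. The functions $\theta(\tau/4)$, $\theta(\tau)$, $\eta^\flat(\tau/2)$ and $\eta^\sharp(2\tau)$ belong to $\mathcal M(\Gamma(4))_{1/2}$, the function $\eta^6$ belongs to $\mathcal M(\Gamma(4))_{3}$, and $$\mathcal M(\Gamma(4))_{\frac12\mathbb N}=\mathbb C\big[\theta(\tau/4),\theta(\tau)\big]=\mathbb C\big[\eta^\flat(\tau/2),\eta^\sharp(2\tau)\big],$$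 a polynomial ring in two variables: each of the two pairs generates the $\mathbb C$-algebra $\mathcal M(\Gamma(4))_{\frac12\mathbb N}$ and is algebraically independent over $\mathbb C$. Moreover the ideal of cusp forms is principal, generated by $\eta^6$: $$\mathcal S(\Gamma(4))_{\frac12\mathbb N}=\mathcal M(\Gamma(4))_{\frac12\mathbb N}\cdot\eta^6.$$ -/

import Mathlib

/-!
Splitting `θ(τ/4)` into the terms of even and odd index gives `E = θ(τ)` and `O = θ(τ/4) - θ(τ)`.
Under `T` they are multiplied by `1` and `i`, and up to a common constant `S` maps them to `E + O`
and `E - O`, so `SL₂(ℤ)` acts on their span, of which `Γ(4)` fixes every element. Hence the product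
of the six lines `O`, `E - iᵏO`, `E` is preserved up to constants, and its fourth power is a cusp
form of weight `12` and level one: `E O (E⁴ - O⁴)` is a multiple of `η⁶`. In particular `O` has no
zeros on `ℍ`.

At the cusps of `Γ(4)`, the form `O` vanishes only at `i∞`, and there to the first order in
`q^{1/4}`. A form of weight `k/2` minus a multiple of `Eᵏ` vanishes at `i∞`, so its quotient by `O`
is again a form, of weight `(k-1)/2`; by induction `E` and `O` generate the ring. They are
algebraically independent because a homogeneous relation would leave only finitely many values for
the nonconstant function `O/E`. Dividing a cusp form by `η⁶`, whose only zeros are simple ones at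
the cusps, shows that the cusp ideal is principal.

Finally `E(τ)² = E(2τ)² + O(2τ)²` and `O(τ)² = 2E(2τ)O(2τ)` turn the product formula for `η⁶` into
an identity between twelfth powers, which shows that `η^♯(2τ)` is a multiple of `O`; applying `S`,
`η^♭(τ/2)` is a multiple of `E - O`.
-/

open scoped UpperHalfPlane MatrixGroups Manifold DirectSum

namespace HalfIntegralWeight

/-- The Kronecker symbol `(n | m)` for arbitrary integers `n`, `m`: the completely multiplicative
extension in `m` of the Legendre symbol with `(n | 2) = χ₈(n)`, with `(n | -1) = -1` if `n < 0`
and `1` otherwise, and with `(n | 0) = 1` if `n = ±1` and `0` otherwise. -/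
def kroneckerSymbol (n m : ℤ) : ℤ :=
  if m = 0 then (if n = 1 ∨ n = -1 then 1 else 0)
  else (if m < 0 ∧ n < 0 then -1 else 1) * ZMod.χ₈ (n : ZMod 8) ^ padicValNat 2 m.natAbs
    * jacobiSym n (m.natAbs / 2 ^ padicValNat 2 m.natAbs)

/-- The factor of weight `1/2`: `J(γ, τ) = (c | d) √(cτ + d)` for `γ = (a b; c d) ∈ SL₂(ℤ)`, with the
principal square root. The factor of weight `k/2` is its `k`-th power (see
`halfFactor_pow_two_mul` and `halfFactor_pow_two_mul_add_one`). -/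
noncomputable def halfFactor (γ : SL(2, ℤ)) (τ : ℍ) : ℂ :=
  (kroneckerSymbol (γ 1 0) (γ 1 1) : ℂ) * (((γ 1 0 : ℤ) : ℂ) * (τ : ℂ) + ((γ 1 1 : ℤ) : ℂ)) ^ (1 / 2 : ℂ)

/-- The operator `f ↦ f|_{k/2} γ` of weight `k/2`. -/
noncomputable def halfSlash (k : ℕ) (f : ℍ → ℂ) (γ : SL(2, ℤ)) : ℍ → ℂ :=
  fun τ => f (γ • τ) / halfFactor γ τ ^ k

theorem kroneckerSymbol_sq {n m : ℤ} (h : IsCoprime n m) : kroneckerSymbol n m ^ 2 = 1 := by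
  unfold kroneckerSymbol
  split_ifs with h0 h1 h2
  · norm_num
  · exfalso
    subst h0
    rw [isCoprime_zero_right, Int.isUnit_iff] at h
    exact h1 h
  all_goals
    have hodd : jacobiSym n (m.natAbs / 2 ^ padicValNat 2 m.natAbs) ^ 2 = 1 := by
      apply jacobiSym.sq_one
      have h3 : Nat.Coprime n.natAbs m.natAbs := Int.isCoprime_iff_gcd_eq_one.mp h
      exact Nat.Coprime.coprime_dvd_right (Nat.div_dvd_of_dvd pow_padicValNat_dvd) h3
    have htwo : (ZMod.χ₈ (n : ZMod 8) ^ padicValNat 2 m.natAbs) ^ 2 = 1 := by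
      by_cases hv : padicValNat 2 m.natAbs = 0
      · simp [hv]
      · have h2 : ¬ (2 : ℤ) ∣ n := by
          intro hd
          have hm : (2 : ℤ) ∣ m := by
            have := dvd_of_one_le_padicValNat (Nat.one_le_iff_ne_zero.mpr hv)
            omega
          have := h.isUnit_of_dvd' hd hm
          norm_num [Int.isUnit_iff] at this
        rw [← pow_mul, mul_comm, pow_mul]
        have : (ZMod.χ₈ (n : ZMod 8)) ^ 2 = 1 := by
          have hx : n % 8 = 1 ∨ n % 8 = 3 ∨ n % 8 = 5 ∨ n % 8 = 7 := by omega
          rw [ZMod.χ₈_int_mod_eight]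
          rcases hx with hx | hx | hx | hx <;> rw [hx] <;> decide
        rw [this, one_pow]
    simp only [mul_pow, hodd, htwo]
    norm_num

theorem isCoprime_lower_row (γ : SL(2, ℤ)) : IsCoprime (γ 1 0) (γ 1 1) := by
  have h := γ.det_coe
  rw [Matrix.det_fin_two] at h
  exact ⟨-γ 0 1, γ 0 0, by linarith⟩

theorem halfFactor_sq (γ : SL(2, ℤ)) (τ : ℍ) :
    halfFactor γ τ ^ 2 = ((γ 1 0 : ℤ) : ℂ) * (τ : ℂ) + ((γ 1 1 : ℤ) : ℂ) := by
  have h : (kroneckerSymbol (γ 1 0) (γ 1 1) : ℂ) ^ 2 = 1 := by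
    exact_mod_cast kroneckerSymbol_sq (isCoprime_lower_row γ)
  rw [halfFactor, mul_pow, h, one_mul, ← Complex.cpow_nat_mul]
  norm_num

/-- In integral weight `m` one gets the usual factor `(cτ + d) ^ m`. -/
theorem halfFactor_pow_two_mul (γ : SL(2, ℤ)) (τ : ℍ) (m : ℕ) :
    halfFactor γ τ ^ (2 * m) = (((γ 1 0 : ℤ) : ℂ) * (τ : ℂ) + ((γ 1 1 : ℤ) : ℂ)) ^ m := by
  rw [pow_mul, halfFactor_sq]

/-- In weight `k/2` with `k` odd one gets the factor `(c | d) √(cτ + d) ^ k`. -/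
theorem halfFactor_pow_two_mul_add_one (γ : SL(2, ℤ)) (τ : ℍ) (m : ℕ) :
    halfFactor γ τ ^ (2 * m + 1) = (kroneckerSymbol (γ 1 0) (γ 1 1) : ℂ) *
      ((((γ 1 0 : ℤ) : ℂ) * (τ : ℂ) + ((γ 1 1 : ℤ) : ℂ)) ^ (1 / 2 : ℂ)) ^ (2 * m + 1) := by
  have h : (kroneckerSymbol (γ 1 0) (γ 1 1) : ℂ) ^ 2 = 1 := by
    exact_mod_cast kroneckerSymbol_sq (isCoprime_lower_row γ)
  rw [halfFactor, mul_pow, pow_succ (kroneckerSymbol _ _ : ℂ), pow_mul (kroneckerSymbol _ _ : ℂ), h,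
    one_pow, one_mul]

theorem halfSlash_zero (k : ℕ) (γ : SL(2, ℤ)) : halfSlash k 0 γ = 0 := by
  ext τ; simp [halfSlash]

theorem halfSlash_add (k : ℕ) (f g : ℍ → ℂ) (γ : SL(2, ℤ)) :
    halfSlash k (f + g) γ = halfSlash k f γ + halfSlash k g γ := by
  ext τ; simp [halfSlash, add_div]

theorem halfSlash_smul (k : ℕ) (a : ℂ) (f : ℍ → ℂ) (γ : SL(2, ℤ)) :
    halfSlash k (a • f) γ = a • halfSlash k f γ := by
  ext τ; simp [halfSlash, mul_div_assoc]

theorem halfSlash_mul (j k : ℕ) (f g : ℍ → ℂ) (γ : SL(2, ℤ)) :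
    halfSlash (j + k) (f * g) γ = halfSlash j f γ * halfSlash k g γ := by
  ext τ; simp [halfSlash, pow_add, mul_div_mul_comm]

theorem halfSlash_one (γ : SL(2, ℤ)) : halfSlash 0 1 γ = 1 := by
  ext τ; simp [halfSlash]

/-- `M(Γ)_{k/2}`: the space of modular forms of weight `k/2` for `Γ`. -/
noncomputable def modForms (Γ : Subgroup SL(2, ℤ)) (k : ℕ) : Submodule ℂ (ℍ → ℂ) where
  carrier := {f | MDifferentiable 𝓘(ℂ) 𝓘(ℂ) f ∧ (∀ γ ∈ Γ, halfSlash k f γ = f) ∧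
    ∀ α : SL(2, ℤ), UpperHalfPlane.IsBoundedAtImInfty (halfSlash k f α)}
  zero_mem' := by
    refine ⟨mdifferentiable_const, fun γ _ => halfSlash_zero k γ, fun α => ?_⟩
    rw [halfSlash_zero]
    exact UpperHalfPlane.zero_form_isBoundedAtImInfty
  add_mem' := by
    rintro f g ⟨hf, hf', hf''⟩ ⟨hg, hg', hg''⟩
    refine ⟨hf.add hg, fun γ h => by rw [halfSlash_add, hf' γ h, hg' γ h], fun α => ?_⟩
    rw [halfSlash_add]
    exact (UpperHalfPlane.boundedAtImInftySubalgebra ℂ).add_mem (hf'' α) (hg'' α)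
  smul_mem' := by
    rintro a f ⟨hf, hf', hf''⟩
    refine ⟨hf.const_smul a, fun γ h => by rw [halfSlash_smul, hf' γ h], fun α => ?_⟩
    rw [halfSlash_smul]
    exact (UpperHalfPlane.boundedAtImInftySubalgebra ℂ).smul_mem (hf'' α) a

/-- `S(Γ)_{k/2}`: the space of cusp forms of weight `k/2` for `Γ`. -/
noncomputable def cuspForms (Γ : Subgroup SL(2, ℤ)) (k : ℕ) : Submodule ℂ (ℍ → ℂ) where
  carrier := {f | MDifferentiable 𝓘(ℂ) 𝓘(ℂ) f ∧ (∀ γ ∈ Γ, halfSlash k f γ = f) ∧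
    ∀ α : SL(2, ℤ), UpperHalfPlane.IsZeroAtImInfty (halfSlash k f α)}
  zero_mem' := by
    refine ⟨mdifferentiable_const, fun γ _ => halfSlash_zero k γ, fun α => ?_⟩
    rw [halfSlash_zero]
    exact (UpperHalfPlane.zeroAtImInftySubmodule ℂ).zero_mem
  add_mem' := by
    rintro f g ⟨hf, hf', hf''⟩ ⟨hg, hg', hg''⟩
    refine ⟨hf.add hg, fun γ h => by rw [halfSlash_add, hf' γ h, hg' γ h], fun α => ?_⟩
    rw [halfSlash_add]
    exact (UpperHalfPlane.zeroAtImInftySubmodule ℂ).add_mem (hf'' α) (hg'' α)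
  smul_mem' := by
    rintro a f ⟨hf, hf', hf''⟩
    refine ⟨hf.const_smul a, fun γ h => by rw [halfSlash_smul, hf' γ h], fun α => ?_⟩
    rw [halfSlash_smul]
    exact (UpperHalfPlane.zeroAtImInftySubmodule ℂ).smul_mem a (hf'' α)

/-- Products of forms of weights `j/2` and `k/2` have weight `(j + k)/2`, so `⨁ k, modForms Γ k`
is a commutative graded `ℂ`-algebra. -/
instance modForms_gradedMonoid (Γ : Subgroup SL(2, ℤ)) : SetLike.GradedMonoid (modForms Γ) where
  one_mem := by
    refine ⟨mdifferentiable_const, fun γ _ => halfSlash_one γ, fun α => ?_⟩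
    rw [halfSlash_one]
    exact (UpperHalfPlane.boundedAtImInftySubalgebra ℂ).one_mem
  mul_mem := by
    rintro j k f g ⟨hf, hf', hf''⟩ ⟨hg, hg', hg''⟩
    refine ⟨hf.mul hg, fun γ h => by rw [halfSlash_mul, hf' γ h, hg' γ h], fun α => ?_⟩
    rw [halfSlash_mul]
    exact (UpperHalfPlane.boundedAtImInftySubalgebra ℂ).mul_mem (hf'' α) (hg'' α)

/-- `M(Γ)_{½ℕ} = ⨁_{k ≥ 0} M(Γ)_{k/2}`, the graded ring of modular forms of half-integral weight;
the component with index `k` consists of the forms of weight `k/2`. -/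
abbrev ModRing (Γ : Subgroup SL(2, ℤ)) : Type := ⨁ k : ℕ, modForms Γ k

theorem mul_mem_cuspForms {Γ : Subgroup SL(2, ℤ)} {j k : ℕ} {f g : ℍ → ℂ}
    (hf : f ∈ modForms Γ j) (hg : g ∈ cuspForms Γ k) : f * g ∈ cuspForms Γ (j + k) := by
  obtain ⟨hf, hf', hf''⟩ := hf
  obtain ⟨hg, hg', hg''⟩ := hg
  refine ⟨hf.mul hg, fun γ h => by rw [halfSlash_mul, hf' γ h, hg' γ h], fun α => ?_⟩
  rw [halfSlash_mul]
  exact Filter.BoundedAtFilter.mul_zeroAtFilter (hf'' α) (hg'' α)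

/-- `S(Γ)_{½ℕ} = ⨁_{k ≥ 0} S(Γ)_{k/2}` as an ideal of `M(Γ)_{½ℕ}`: the elements all of whose
components are cusp forms. -/
noncomputable def cuspIdeal (Γ : Subgroup SL(2, ℤ)) : Ideal (ModRing Γ) where
  carrier := {F | ∀ k, (F k : ℍ → ℂ) ∈ cuspForms Γ k}
  zero_mem' := fun k => by simp
  add_mem' := fun {F G} hF hG k => by
    simpa using (cuspForms Γ k).add_mem (hF k) (hG k)
  smul_mem' := fun F G hG k => by
    classical
    rw [smul_eq_mul, DirectSum.coe_mul_apply]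
    refine Submodule.sum_mem _ fun ij hij => ?_
    rw [← (Finset.mem_filter.mp hij).2]
    exact mul_mem_cuspForms (F ij.1).2 (hG ij.2)

/-- `θ(τ) = ∑_{n ∈ ℤ} q^{n²}` with `q = e^{2πiτ}`. -/
noncomputable def theta (τ : ℂ) : ℂ :=
  ∑' n : ℤ, Complex.exp (2 * Real.pi * Complex.I * (n : ℂ) ^ 2 * τ)

/-- `η^♭(τ) = η(τ/2)² / η(τ)`, with `η` the Dedekind eta function. -/
noncomputable def etaFlat (τ : ℂ) : ℂ := ModularForm.eta (τ / 2) ^ 2 / ModularForm.eta τ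

/-- `η^♯(τ) = η(2τ)² / η(τ)`, with `η` the Dedekind eta function. -/
noncomputable def etaSharp (τ : ℂ) : ℂ := ModularForm.eta (2 * τ) ^ 2 / ModularForm.eta τ

/-- A modular form of weight `k/2` as a homogeneous element of the graded ring. -/
noncomputable def ModRing.form {Γ : Subgroup SL(2, ℤ)} {k : ℕ} {f : ℍ → ℂ}
    (hf : f ∈ modForms Γ k) : ModRing Γ :=
  DirectSum.of (fun k : ℕ => modForms Γ k) k ⟨f, hf⟩

end HalfIntegralWeight

open HalfIntegralWeight CongruenceSubgroup

namespace HalfIntegralWeight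

open ModularGroup UpperHalfPlane Filter Topology Asymptotics

/-! ### The Kronecker symbol -/

theorem kroneckerSymbol_of_odd (n : ℤ) {m : ℤ} (hm : Odd m) :
    kroneckerSymbol n m = (if m < 0 ∧ n < 0 then -1 else 1) * jacobiSym n m.natAbs := by
  have hm₀ : m ≠ 0 := by rintro rfl; simp at hm
  have hm₂ : padicValNat 2 m.natAbs = 0 :=
    padicValNat.eq_zero_of_not_dvd (Nat.two_dvd_ne_zero.mpr (Nat.odd_iff.mp hm.natAbs))
  simp [kroneckerSymbol, hm₀, hm₂]

theorem jacobiSym_congr_right {n : ℤ} {a b : ℕ} (h4 : 4 ∣ n) (ha : Odd a) (hb : Odd b)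
    (h : a ≡ b [MOD n.natAbs]) : jacobiSym n a = jacobiSym n b := by
  obtain ⟨c, rfl⟩ := h4
  rw [Int.natAbs_mul] at h
  rw [jacobiSym.mul_left, jacobiSym.mul_left, jacobiSym.at_four ha, jacobiSym.at_four hb,
    jacobiSym.mod_right c ha, jacobiSym.mod_right c hb,
    show a % (4 * c.natAbs) = b % (4 * c.natAbs) from h]

theorem jacobiSym_natAbs_sub_one {n : ℤ} (h4 : 4 ∣ n) (hn : n ≠ 0) :
    jacobiSym n (n.natAbs - 1) = if n < 0 then -1 else 1 := by
  have hodd : Odd (n.natAbs - 1) := by rw [Nat.odd_iff]; omega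
  have hpos : jacobiSym n.natAbs (n.natAbs - 1) = 1 := by
    rw [← jacobiSym.one_left (n.natAbs - 1)]
    refine jacobiSym.mod_left' ?_
    rw [Nat.cast_sub (by omega), Nat.cast_one]
    simpa using Int.add_emod_left ((n.natAbs : ℤ) - 1) 1
  split_ifs with hneg
  · rw [show n = -(n.natAbs : ℤ) by omega, Int.natAbs_neg, Int.natAbs_natCast,
      jacobiSym.neg _ hodd, hpos, ZMod.χ₄_nat_three_mod_four (by omega), mul_one]
  · rwa [show n = (n.natAbs : ℤ) by omega, Int.natAbs_natCast]

theorem jacobiSym_of_dvd_add {n : ℤ} {a b : ℕ} (h4 : 4 ∣ n) (hn : n ≠ 0) (ha : Odd a)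
    (hb : Odd b) (h : n.natAbs ∣ a + b) :
    jacobiSym n b = (if n < 0 then -1 else 1) * jacobiSym n a := by
  have hodd : Odd (n.natAbs - 1) := by rw [Nat.odd_iff]; omega
  have hcongr : b ≡ (n.natAbs - 1) * a [MOD n.natAbs] := by
    rw [← Int.natCast_modEq_iff, Int.modEq_iff_dvd, Nat.cast_mul, Nat.cast_sub (by omega),
      Nat.cast_one]
    obtain ⟨k, hk⟩ := h
    have hk' : (a : ℤ) + b = n.natAbs * k := by exact_mod_cast hk
    exact ⟨a - k, by linear_combination -hk'⟩
  rw [jacobiSym_congr_right h4 hb (hodd.mul ha) hcongr,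
    jacobiSym.mul_right' _ hodd.pos.ne' ha.pos.ne', jacobiSym_natAbs_sub_one h4 hn]

theorem kroneckerSymbol_add_right {n m : ℤ} (h4 : 4 ∣ n) (hm : Odd m) :
    kroneckerSymbol n (m + n) = kroneckerSymbol n m := by
  rcases eq_or_ne n 0 with rfl | hn
  · rw [add_zero]
  have hmn : Odd (m + n) := hm.add_even (even_iff_two_dvd.mpr (dvd_trans (by norm_num) h4))
  rw [kroneckerSymbol_of_odd _ hm, kroneckerSymbol_of_odd _ hmn]
  by_cases hs : m < 0 ↔ m + n < 0
  · rw [jacobiSym_congr_right h4 hmn.natAbs hm.natAbs]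
    · simp only [hs]
    · rw [← Int.natCast_modEq_iff, Int.modEq_iff_dvd, Int.natCast_natAbs, abs_dvd]
      rcases lt_or_ge m 0 with hneg | hneg
      · exact ⟨1, by omega⟩
      · exact ⟨-1, by omega⟩
  · rw [jacobiSym_of_dvd_add h4 hn hm.natAbs hmn.natAbs
      (by rw [show m.natAbs + (m + n).natAbs = n.natAbs by omega]), ← mul_assoc]
    congr 1
    split_ifs <;> first | rfl | omega

/-- For a negative denominator `(n | m)` is periodic in `n` only up to the sign of `n`. -/
theorem kroneckerSymbol_add_mul_left {n m : ℤ} (k : ℤ) (hm : Odd m) :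
    kroneckerSymbol (n + k * m) m =
      (if m < 0 ∧ ¬(n + k * m < 0 ↔ n < 0) then -1 else 1) * kroneckerSymbol n m := by
  have hper : jacobiSym (n + k * m) m.natAbs = jacobiSym n m.natAbs := by
    refine jacobiSym.mod_left' ?_
    rw [Int.natCast_natAbs, Int.emod_abs, Int.emod_abs, Int.add_mul_emod_self_right]
  rw [kroneckerSymbol_of_odd _ hm, kroneckerSymbol_of_odd _ hm, hper, ← mul_assoc]
  congr 1
  split_ifs <;> first | rfl | omega

theorem kroneckerSymbol_four_mul_left (n : ℤ) {m : ℤ} (hm : Odd m) :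
    kroneckerSymbol (4 * n) m = kroneckerSymbol n m := by
  rw [kroneckerSymbol_of_odd _ hm, kroneckerSymbol_of_odd _ hm, jacobiSym.mul_left,
    jacobiSym.at_four hm.natAbs, one_mul]
  congr 1
  split_ifs <;> first | rfl | omega

/-! ### The principal square root -/

theorem sqrt_ne_zero {z : ℂ} (hz : z ≠ 0) : z ^ (1 / 2 : ℂ) ≠ 0 := by
  simp [Complex.cpow_eq_zero_iff, hz]

theorem sqrt_sq (z : ℂ) : (z ^ (1 / 2 : ℂ)) ^ 2 = z := by
  rw [← Complex.cpow_nat_mul]; norm_num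

theorem eq_sqrt_of_sq_eq {w z : ℂ} (h : w ^ 2 = z) (hw : 0 < w.re) : w = z ^ (1 / 2 : ℂ) := by
  rw [← h, one_div, Complex.sq_cpow_two_inv hw]

theorem sqrt_re_pos {z : ℂ} (hz : z ∈ Complex.slitPlane) : 0 < (z ^ (1 / 2 : ℂ)).re := by
  rw [one_div, Complex.cpow_inv_two_re, Real.sqrt_pos]
  rcases hz with hre | him
  · linarith [norm_nonneg z]
  · linarith [neg_le_abs z.re, Complex.abs_re_lt_norm.mpr him]

theorem two_mul_sqrt_re_mul_sqrt_im (z : ℂ) :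
    2 * (z ^ (1 / 2 : ℂ)).re * (z ^ (1 / 2 : ℂ)).im = z.im := by
  have h := congrArg Complex.im (sqrt_sq z)
  rw [sq, Complex.mul_im] at h
  linarith

theorem sqrt_im_pos {z : ℂ} (hz : 0 < z.im) : 0 < (z ^ (1 / 2 : ℂ)).im :=
  pos_of_mul_pos_right (two_mul_sqrt_re_mul_sqrt_im z ▸ hz)
    (by linarith [sqrt_re_pos (Or.inr hz.ne')])

theorem sqrt_im_nonneg {z : ℂ} (hz : 0 ≤ z.im) : 0 ≤ (z ^ (1 / 2 : ℂ)).im := by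
  rw [one_div, Complex.cpow_inv_two_im_eq_sqrt hz]
  exact Real.sqrt_nonneg _

theorem sqrt_im_neg {z : ℂ} (hz : z.im < 0) : (z ^ (1 / 2 : ℂ)).im < 0 := by
  have h := two_mul_sqrt_re_mul_sqrt_im z
  have hre := sqrt_re_pos (Or.inr hz.ne)
  by_contra! him
  nlinarith [mul_nonneg hre.le him]

theorem sqrt_mul_of_im_neg_of_im_pos {z w : ℂ} (hz : z.im < 0) (hw : 0 < w.im) :
    (z * w) ^ (1 / 2 : ℂ) = z ^ (1 / 2 : ℂ) * w ^ (1 / 2 : ℂ) := by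
  refine (eq_sqrt_of_sq_eq (by rw [mul_pow, sqrt_sq, sqrt_sq]) ?_).symm
  rw [Complex.mul_re, sub_pos]
  exact (mul_neg_of_neg_of_pos (sqrt_im_neg hz) (sqrt_im_pos hw)).trans
    (mul_pos (sqrt_re_pos (Or.inr hz.ne)) (sqrt_re_pos (Or.inr hw.ne')))

/-- The product of the square roots lies in the upper half-plane, so its real part has the sign of
the imaginary part of its square `z * w`. -/
theorem sqrt_mul_of_im_nonneg_of_im_pos {z w : ℂ} (hz : z ∈ Complex.slitPlane) (hz' : 0 ≤ z.im)
    (hw : 0 < w.im) (hzw : (z * w).im ≠ 0) :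
    (z * w) ^ (1 / 2 : ℂ) =
      (if (z * w).im < 0 then -1 else 1) * (z ^ (1 / 2 : ℂ) * w ^ (1 / 2 : ℂ)) := by
  set p := z ^ (1 / 2 : ℂ) * w ^ (1 / 2 : ℂ) with hp
  have hp_sq : p ^ 2 = z * w := by rw [hp, mul_pow, sqrt_sq, sqrt_sq]
  have hp_im : 0 < p.im := by
    rw [hp, Complex.mul_im]
    exact add_pos_of_pos_of_nonneg (mul_pos (sqrt_re_pos hz) (sqrt_im_pos hw))
      (mul_nonneg (sqrt_im_nonneg hz') (sqrt_re_pos (Or.inr hw.ne')).le)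
  have hp_re : 2 * p.re * p.im = (z * w).im := by
    rw [← hp_sq, sq, Complex.mul_im p p]; ring
  split_ifs with h
  · refine (eq_sqrt_of_sq_eq (by rw [mul_pow, hp_sq]; ring) ?_).symm
    rw [neg_one_mul, Complex.neg_re]
    nlinarith
  · rw [one_mul]
    refine (eq_sqrt_of_sq_eq hp_sq ?_).symm
    have := lt_of_le_of_ne (not_lt.mp h) hzw.symm
    nlinarith

theorem abs_sqrt_im_lt_sqrt_re {z : ℂ} (hz : 0 < z.re) :
    |(z ^ (1 / 2 : ℂ)).im| < (z ^ (1 / 2 : ℂ)).re := by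
  have h := congrArg Complex.re (sqrt_sq z)
  rw [sq, Complex.mul_re] at h
  exact abs_lt_of_sq_lt_sq (by nlinarith) (sqrt_re_pos (Or.inl hz)).le

theorem sqrt_mul_of_re_pos {z w : ℂ} (hz : 0 < z.re) (hw : 0 < w.re) :
    (z * w) ^ (1 / 2 : ℂ) = z ^ (1 / 2 : ℂ) * w ^ (1 / 2 : ℂ) := by
  refine (eq_sqrt_of_sq_eq (by rw [mul_pow, sqrt_sq, sqrt_sq]) ?_).symm
  rw [Complex.mul_re, sub_pos]
  calc _ ≤ |(z ^ (1 / 2 : ℂ)).im * (w ^ (1 / 2 : ℂ)).im| := le_abs_self _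
    _ = |(z ^ (1 / 2 : ℂ)).im| * |(w ^ (1 / 2 : ℂ)).im| := abs_mul _ _
    _ < _ := mul_lt_mul'' (abs_sqrt_im_lt_sqrt_re hz) (abs_sqrt_im_lt_sqrt_re hw)
      (abs_nonneg _) (abs_nonneg _)

/-! ### Generators of `Γ₁(4)` -/

theorem mem_Gamma1_four {γ : SL(2, ℤ)} : γ ∈ Gamma1 4 ↔ 4 ∣ γ 1 0 ∧ γ 1 1 % 4 = 1 := by
  have hdet := γ.det_coe
  rw [Matrix.det_fin_two] at hdet
  have h₁ (n : ℤ) : (n : ZMod 4) = 1 ↔ n % 4 = 1 := by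
    exact_mod_cast ZMod.intCast_eq_intCast_iff' n 1 4
  have h₀ : ((γ 1 0 : ℤ) : ZMod 4) = 0 ↔ 4 ∣ γ 1 0 := ZMod.intCast_zmod_eq_zero_iff_dvd _ 4
  rw [Gamma1_mem, h₁, h₁, h₀]
  refine ⟨fun h => ⟨h.2.2, h.2.1⟩, fun ⟨⟨c, hc⟩, hd⟩ => ⟨?_, hd, ⟨c, hc⟩⟩⟩
  have hd' : γ 1 1 = 4 * (γ 1 1 / 4) + 1 := by omega
  have : γ 0 0 = 1 + 4 * (γ 0 1 * c - γ 0 0 * (γ 1 1 / 4)) := by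
    rw [hc] at hdet; linear_combination hdet - γ 0 0 * hd'
  omega

theorem odd_lower_right_of_mem_Gamma1_four {γ : SL(2, ℤ)} (hγ : γ ∈ Gamma1 4) : Odd (γ 1 1) := by
  rw [Int.odd_iff]
  have := (mem_Gamma1_four.mp hγ).2
  omega

/-- The matrix `(1 0; 4 1)`, which generates `Γ₁(4)` together with `T = (1 1; 0 1)`. -/
def lowerFour : SL(2, ℤ) := ⟨!![1, 0; 4, 1], by simp⟩

theorem coe_lowerFour : (lowerFour : Matrix (Fin 2) (Fin 2) ℤ) = !![1, 0; 4, 1] := rfl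

theorem lowerFour_mem_Gamma1_four : lowerFour ∈ Gamma1 4 := by
  rw [mem_Gamma1_four]; simp [coe_lowerFour]

theorem T_mem_Gamma1_four : T ∈ Gamma1 4 := by
  rw [mem_Gamma1_four]; simp [coe_T]

theorem mul_T_zpow_lower_left (γ : SL(2, ℤ)) (n : ℤ) : (γ * T ^ n) 1 0 = γ 1 0 := by
  simp [coe_T_zpow, Matrix.mul_apply]

theorem mul_T_zpow_lower_right (γ : SL(2, ℤ)) (n : ℤ) :
    (γ * T ^ n) 1 1 = γ 1 1 + n * γ 1 0 := by
  simp [coe_T_zpow, Matrix.mul_apply, add_comm, mul_comm]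

theorem coe_lowerFour_inv : (lowerFour⁻¹ : SL(2, ℤ)).1 = !![1, 0; -4, 1] := by
  rw [Matrix.SpecialLinearGroup.coe_inv, coe_lowerFour, Matrix.adjugate_fin_two_of]
  simp

theorem mul_lowerFour_lower_left (γ : SL(2, ℤ)) :
    (γ * lowerFour) 1 0 = γ 1 0 + 4 * γ 1 1 := by
  simp [coe_lowerFour, Matrix.mul_apply, mul_comm]

theorem mul_lowerFour_lower_right (γ : SL(2, ℤ)) : (γ * lowerFour) 1 1 = γ 1 1 := by
  simp [coe_lowerFour, Matrix.mul_apply]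

theorem mul_lowerFour_inv_lower_left (γ : SL(2, ℤ)) :
    (γ * lowerFour⁻¹) 1 0 = γ 1 0 - 4 * γ 1 1 := by
  rw [Matrix.SpecialLinearGroup.coe_mul, coe_lowerFour_inv]
  simp [Matrix.mul_apply, sub_eq_add_neg, mul_comm]

theorem mul_lowerFour_inv_lower_right (γ : SL(2, ℤ)) : (γ * lowerFour⁻¹) 1 1 = γ 1 1 := by
  rw [Matrix.SpecialLinearGroup.coe_mul, coe_lowerFour_inv]
  simp [Matrix.mul_apply]

theorem eq_T_zpow_of_lower_row {γ : SL(2, ℤ)} (hc : γ 1 0 = 0) (hd : γ 1 1 = 1) :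
    γ = T ^ (γ 0 1) := by
  have hdet := γ.det_coe
  rw [Matrix.det_fin_two, hc, hd, mul_one, mul_zero, sub_zero] at hdet
  ext i j
  fin_cases i <;> fin_cases j <;> simp [coe_T_zpow, hc, hd, hdet]

theorem lower_right_eq_one_of_lower_left_eq_zero {γ : SL(2, ℤ)} (hγ : γ ∈ Gamma1 4)
    (hc : γ 1 0 = 0) : γ 1 1 = 1 := by
  have hcop := isCoprime_lower_row γ
  rw [hc, isCoprime_zero_left, Int.isUnit_iff] at hcop
  have := (mem_Gamma1_four.mp hγ).2
  omega

/-- Euclid's algorithm on the lower row `(c, d)`: a power of `(1 0; 4 1)` shortens it if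
`2|d| < |c|`, a power of `T` if `2|d| > |c|`. -/
theorem closure_T_lowerFour : Subgroup.closure {T, lowerFour} = Gamma1 4 := by
  set H := Subgroup.closure {T, lowerFour}
  have hT (n : ℤ) : T ^ n ∈ H := H.zpow_mem (Subgroup.subset_closure (by simp)) n
  have hU : lowerFour ∈ H := Subgroup.subset_closure (by simp)
  refine le_antisymm ?_ fun γ hγ => ?_
  · rw [Subgroup.closure_le]
    rintro γ (rfl | rfl)
    exacts [T_mem_Gamma1_four, lowerFour_mem_Gamma1_four]
  induction hN : (γ 1 0).natAbs + (γ 1 1).natAbs using Nat.strong_induction_on generalizing γ with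
  | _ N ih =>
  have hγ' := mem_Gamma1_four.mp hγ
  rcases eq_or_ne (γ 1 0) 0 with hc | hc
  · rw [eq_T_zpow_of_lower_row hc (lower_right_eq_one_of_lower_left_eq_zero hγ hc)]
    exact hT _
  have shorten_T (n : ℤ) (h : (γ 1 1 + n * γ 1 0).natAbs < (γ 1 1).natAbs) : γ ∈ H := by
    rw [← H.mul_mem_cancel_right (hT n)]
    refine ih _ ?_ _ ((Gamma1 4).mul_mem hγ ((Gamma1 4).zpow_mem T_mem_Gamma1_four n)) rfl
    rw [mul_T_zpow_lower_left, mul_T_zpow_lower_right]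
    omega
  have shorten_U (h : (γ 1 0 + 4 * γ 1 1).natAbs < (γ 1 0).natAbs) : γ ∈ H := by
    rw [← H.mul_mem_cancel_right hU]
    refine ih _ ?_ _ ((Gamma1 4).mul_mem hγ lowerFour_mem_Gamma1_four) rfl
    rw [mul_lowerFour_lower_left, mul_lowerFour_lower_right]
    omega
  have shorten_U_inv (h : (γ 1 0 - 4 * γ 1 1).natAbs < (γ 1 0).natAbs) : γ ∈ H := by
    rw [← H.mul_mem_cancel_right (H.inv_mem hU)]
    refine ih _ ?_ _ ((Gamma1 4).mul_mem hγ ((Gamma1 4).inv_mem lowerFour_mem_Gamma1_four)) rfl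
    rw [mul_lowerFour_inv_lower_left, mul_lowerFour_inv_lower_right]
    omega
  by_cases hle : 2 * (γ 1 1).natAbs < (γ 1 0).natAbs <;> by_cases hs : 0 < γ 1 0 ↔ 0 < γ 1 1
  · exact shorten_U_inv (by omega)
  · exact shorten_U (by omega)
  · exact shorten_T (-1) (by omega)
  · exact shorten_T 1 (by omega)

/-! ### The theta multiplier -/

theorem im_intCast_mul_coe_add_intCast (c d : ℤ) (τ : ℍ) :
    ((c : ℂ) * τ + d).im = c * τ.im := by
  simp

theorem intCast_mul_coe_add_intCast_mem_slitPlane {c d : ℤ} (h : c ≠ 0 ∨ 0 < d) (τ : ℍ) :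
    (c : ℂ) * τ + d ∈ Complex.slitPlane := by
  rcases eq_or_ne c 0 with rfl | hc
  · left; simpa using h
  · right
    rw [im_intCast_mul_coe_add_intCast]
    exact mul_ne_zero (Int.cast_ne_zero.mpr hc) τ.im_ne_zero

theorem four_mul_coe_add_one_im_pos (τ : ℍ) : 0 < (4 * (τ : ℂ) + 1).im := by
  simpa using τ.im_pos

theorem four_mul_coe_add_one_ne_zero (τ : ℍ) : 4 * (τ : ℂ) + 1 ≠ 0 := fun h =>
  (four_mul_coe_add_one_im_pos τ).ne' (by rw [h, Complex.zero_im])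

theorem coe_lowerFour_smul (τ : ℍ) : ((lowerFour • τ : ℍ) : ℂ) = τ / (4 * τ + 1) := by
  rw [UpperHalfPlane.specialLinearGroup_apply]
  simp [coe_lowerFour]

theorem halfFactor_mul_T {γ : SL(2, ℤ)} (hγ : γ ∈ Gamma1 4) (τ : ℍ) :
    halfFactor (γ * T) τ = halfFactor γ (T • τ) := by
  have hc := mul_T_zpow_lower_left γ 1
  have hd := mul_T_zpow_lower_right γ 1
  rw [zpow_one] at hc hd
  rw [halfFactor, halfFactor, hc, hd, one_mul, kroneckerSymbol_add_right
    (mem_Gamma1_four.mp hγ).1 (odd_lower_right_of_mem_Gamma1_four hγ),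
    UpperHalfPlane.modular_T_smul, UpperHalfPlane.coe_vadd]
  congr 2
  push_cast; ring

/-- The Kronecker symbol and the principal square root fail to be multiplicative in exactly the same
case: when `c ≥ 0` and `c + 4d < 0`. -/
theorem halfFactor_mul_lowerFour {γ : SL(2, ℤ)} (hγ : γ ∈ Gamma1 4) (τ : ℍ) :
    halfFactor (γ * lowerFour) τ =
      halfFactor γ (lowerFour • τ) * (4 * (τ : ℂ) + 1) ^ (1 / 2 : ℂ) := by
  have hc₀ := lower_right_eq_one_of_lower_left_eq_zero hγ
  have hc₁ := lower_right_eq_one_of_lower_left_eq_zero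
    ((Gamma1 4).mul_mem hγ lowerFour_mem_Gamma1_four)
  rw [halfFactor, halfFactor, mul_lowerFour_lower_left, mul_lowerFour_lower_right,
    kroneckerSymbol_add_mul_left 4 (odd_lower_right_of_mem_Gamma1_four hγ)]
  rw [mul_lowerFour_lower_left, mul_lowerFour_lower_right] at hc₁
  generalize γ 1 0 = c at *
  generalize γ 1 1 = d at *
  have hw : ((lowerFour • τ : ℍ) : ℂ) * (4 * (τ : ℂ) + 1) = τ := by
    rw [coe_lowerFour_smul, div_mul_cancel₀ _ (four_mul_coe_add_one_ne_zero τ)]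
  generalize lowerFour • τ = w at *
  have hmul : ((c + 4 * d : ℤ) : ℂ) * τ + d = (c * w + d) * (4 * (τ : ℂ) + 1) := by
    push_cast; linear_combination -(c : ℂ) * hw
  have hmul_im := im_intCast_mul_coe_add_intCast (c + 4 * d) d τ
  rw [hmul] at hmul_im
  rw [hmul]
  rcases lt_or_ge c 0 with hc | hc
  · have hz : ((c : ℂ) * w + d).im < 0 := by
      rw [im_intCast_mul_coe_add_intCast]
      exact mul_neg_of_neg_of_pos (by exact_mod_cast hc) w.im_pos
    rw [if_neg (by omega), one_mul,
      sqrt_mul_of_im_neg_of_im_pos hz (four_mul_coe_add_one_im_pos τ), mul_assoc]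
  · have hsign : (((c : ℂ) * w + d) * (4 * (τ : ℂ) + 1)).im < 0 ↔ c + 4 * d < 0 := by
      rw [hmul_im, mul_comm, ← smul_eq_mul, smul_neg_iff_of_pos_left τ.im_pos,
        Int.cast_lt_zero]
    rw [sqrt_mul_of_im_nonneg_of_im_pos _ _ (four_mul_coe_add_one_im_pos τ)]
    · simp only [hsign]
      split_ifs <;> first | omega | push_cast; ring
    · rw [hmul_im]
      exact mul_ne_zero (Int.cast_ne_zero.mpr (by omega)) τ.im_ne_zero
    · exact intCast_mul_coe_add_intCast_mem_slitPlane (by omega) w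
    · rw [im_intCast_mul_coe_add_intCast]
      exact mul_nonneg (by exact_mod_cast hc) w.im_pos.le

theorem theta_eq_jacobiTheta (τ : ℂ) : theta τ = jacobiTheta (2 * τ) :=
  tsum_congr fun n => by congr 1; ring

theorem theta_add_one (τ : ℂ) : theta (τ + 1) = theta τ := by
  rw [theta_eq_jacobiTheta, theta_eq_jacobiTheta, mul_add, mul_one, add_comm, jacobiTheta_two_add]

theorem theta_T_smul (τ : ℍ) : theta ((T • τ : ℍ) : ℂ) = theta τ := by
  rw [UpperHalfPlane.modular_T_smul, UpperHalfPlane.coe_vadd, add_comm]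
  exact_mod_cast theta_add_one τ

theorem theta_neg_inv {τ : ℂ} (hτ : 0 < τ.im) :
    theta (-1 / (4 * τ)) = (-2 * Complex.I * τ) ^ (1 / 2 : ℂ) * theta τ := by
  have h := jacobiTheta_S_smul ⟨2 * τ, by simpa using hτ⟩
  rw [UpperHalfPlane.modular_S_smul] at h
  have hτ₀ : τ ≠ 0 := by rintro rfl; simp at hτ
  rw [theta_eq_jacobiTheta, theta_eq_jacobiTheta]
  convert h using 2
  · field_simp; norm_num
  · congr 1; ring

/-- `(1 0; 4 1)` maps `τ` to `-1 / (4w)` with `w = -1 / (4τ) - 1`. -/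
theorem theta_lowerFour_smul (τ : ℍ) :
    theta ((lowerFour • τ : ℍ) : ℂ) = (4 * (τ : ℂ) + 1) ^ (1 / 2 : ℂ) * theta τ := by
  have hτ := UpperHalfPlane.ne_zero τ
  have hden := four_mul_coe_add_one_ne_zero τ
  set w : ℂ := -1 / (4 * (τ : ℂ)) - 1 with hw
  have hw_mul : -4 * w * τ = 4 * τ + 1 := by rw [hw]; field_simp; ring
  have hw_im : 0 < w.im := by
    have := UpperHalfPlane.im_inv_neg_coe_pos ⟨4 * (τ : ℂ), by simpa using τ.im_pos⟩
    simpa [hw, neg_div, inv_neg] using this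
  have hre {z : ℂ} (hz : 0 < z.im) : 0 < (-2 * Complex.I * z).re := by simpa using hz
  have hw₀ : w ≠ 0 := by rintro h; simp [h] at hw_im
  have hsmul : ((lowerFour • τ : ℍ) : ℂ) = -1 / (4 * w) := by
    rw [coe_lowerFour_smul, div_eq_div_iff hden (by simpa using hw₀)]
    linear_combination -hw_mul
  rw [hsmul, theta_neg_inv hw_im, ← theta_add_one w, hw, sub_add_cancel, ← hw,
    theta_neg_inv τ.im_pos, ← mul_assoc, ← sqrt_mul_of_re_pos (hre hw_im) (hre τ.im_pos)]
  congr 2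
  linear_combination hw_mul + 4 * w * τ * Complex.I_sq

theorem theta_smul {γ : SL(2, ℤ)} (hγ : γ ∈ Gamma1 4) (τ : ℍ) :
    theta ((γ • τ : ℍ) : ℂ) = halfFactor γ τ * theta τ := by
  have step_T {γ : SL(2, ℤ)} (hγ : γ ∈ Gamma1 4) (τ : ℍ) :
      theta ((γ * T) • τ : ℍ) = halfFactor (γ * T) τ * theta τ ↔
        theta (γ • T • τ : ℍ) = halfFactor γ (T • τ) * theta (T • τ : ℍ) := by
    rw [mul_smul, halfFactor_mul_T hγ, theta_T_smul]
  have step_U {γ : SL(2, ℤ)} (hγ : γ ∈ Gamma1 4) (τ : ℍ) :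
      theta ((γ * lowerFour) • τ : ℍ) = halfFactor (γ * lowerFour) τ * theta τ ↔
        theta (γ • lowerFour • τ : ℍ) =
          halfFactor γ (lowerFour • τ) * theta (lowerFour • τ : ℍ) := by
    rw [mul_smul, halfFactor_mul_lowerFour hγ, theta_lowerFour_smul, mul_assoc]
  rw [← closure_T_lowerFour] at hγ
  induction hγ using Subgroup.closure_induction_right generalizing τ with
  | one => simp [halfFactor, kroneckerSymbol]
  | mul_right γ hγ ε hε ih =>
    rw [closure_T_lowerFour] at hγ
    rcases hε with rfl | rfl
    · exact (step_T hγ τ).mpr (ih _)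
    · exact (step_U hγ τ).mpr (ih _)
  | mul_inv_cancel γ hγ ε hε ih =>
    rw [closure_T_lowerFour] at hγ
    rcases hε with rfl | rfl
    · have h := (step_T ((Gamma1 4).mul_mem hγ ((Gamma1 4).inv_mem T_mem_Gamma1_four))
        (T⁻¹ • τ)).mp (by simpa using ih (T⁻¹ • τ))
      rwa [smul_inv_smul] at h
    · have h := (step_U ((Gamma1 4).mul_mem hγ ((Gamma1 4).inv_mem lowerFour_mem_Gamma1_four))
        (lowerFour⁻¹ • τ)).mp (by simpa using ih (lowerFour⁻¹ • τ))
      rwa [smul_inv_smul] at h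

/-- Conjugation by `diag(4, 1)` reduces this to `theta_smul`, because `(4c | d) = (c | d)`. -/
theorem theta_smul_div_four {γ : SL(2, ℤ)} (hγ : γ ∈ Gamma1 4) (hb : 4 ∣ γ 0 1) (τ : ℍ) :
    theta (((γ • τ : ℍ) : ℂ) / 4) = halfFactor γ τ * theta ((τ : ℂ) / 4) := by
  obtain ⟨b, hb⟩ := hb
  have hdet := γ.det_coe
  rw [Matrix.det_fin_two, hb] at hdet
  let δ : SL(2, ℤ) := ⟨!![γ 0 0, b; 4 * γ 1 0, γ 1 1], by
    rw [Matrix.det_fin_two_of]; linarith⟩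
  let w : ℍ := ⟨(τ : ℂ) / 4, by simpa using τ.im_pos⟩
  have hδ : δ ∈ Gamma1 4 :=
    mem_Gamma1_four.mpr ⟨dvd_mul_right 4 _, (mem_Gamma1_four.mp hγ).2⟩
  have hsmul : ((δ • w : ℍ) : ℂ) = ((γ • τ : ℍ) : ℂ) / 4 := by
    rw [UpperHalfPlane.coe_specialLinearGroup_apply, UpperHalfPlane.coe_specialLinearGroup_apply]
    simp [δ, w, hb]
    ring_nf
  have hfactor : halfFactor δ w = halfFactor γ τ := by
    rw [halfFactor, halfFactor]
    simp only [δ, w, Matrix.of_apply, Matrix.cons_val', Matrix.cons_val_zero, Matrix.cons_val_one,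
      Matrix.cons_val_fin_one]
    rw [kroneckerSymbol_four_mul_left _ (odd_lower_right_of_mem_Gamma1_four hγ)]
    congr 2
    push_cast; ring
  rw [← hsmul, ← hfactor]
  exact theta_smul hδ w

/-! ### Functions that agree up to a nonzero constant -/

/-- `f` is a nonzero constant multiple of `g`. The multiplier systems of half-integral weight enter
most arguments only up to such a constant. -/
def Proportional {X : Type*} (f g : X → ℂ) : Prop := ∃ c : ℂ, c ≠ 0 ∧ f = c • g

namespace Proportional

variable {X : Type*} {f f' g g' h : X → ℂ}

theorem refl (f : X → ℂ) : Proportional f f := ⟨1, one_ne_zero, (one_smul ℂ f).symm⟩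

theorem symm (hfg : Proportional f g) : Proportional g f := by
  obtain ⟨c, hc, rfl⟩ := hfg
  exact ⟨c⁻¹, inv_ne_zero hc, (inv_smul_smul₀ hc g).symm⟩

theorem trans (hfg : Proportional f g) (hgh : Proportional g h) : Proportional f h := by
  obtain ⟨c, hc, rfl⟩ := hfg
  obtain ⟨d, hd, rfl⟩ := hgh
  exact ⟨c * d, mul_ne_zero hc hd, smul_smul c d h⟩

theorem mul (hfg : Proportional f g) (hfg' : Proportional f' g') :
    Proportional (f * f') (g * g') := by
  obtain ⟨c, hc, rfl⟩ := hfg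
  obtain ⟨d, hd, rfl⟩ := hfg'
  exact ⟨c * d, mul_ne_zero hc hd, smul_mul_smul_comm c g d g'⟩

theorem inv (hfg : Proportional f g) : Proportional f⁻¹ g⁻¹ := by
  obtain ⟨c, hc, rfl⟩ := hfg
  exact ⟨c⁻¹, inv_ne_zero hc, funext fun x => mul_inv c (g x)⟩

theorem div (hfg : Proportional f g) (hfg' : Proportional f' g') :
    Proportional (f / f') (g / g') := by
  rw [div_eq_mul_inv, div_eq_mul_inv]
  exact hfg.mul hfg'.inv

theorem pow (hfg : Proportional f g) (n : ℕ) : Proportional (f ^ n) (g ^ n) := by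
  obtain ⟨c, hc, rfl⟩ := hfg
  exact ⟨c ^ n, pow_ne_zero n hc, smul_pow c g n⟩

theorem comp {Y : Type*} (hfg : Proportional f g) (φ : Y → X) :
    Proportional (f ∘ φ) (g ∘ φ) := by
  obtain ⟨c, hc, rfl⟩ := hfg
  exact ⟨c, hc, rfl⟩

theorem ne_zero (hfg : Proportional f g) {x : X} (hg : g x ≠ 0) : f x ≠ 0 := by
  obtain ⟨c, hc, rfl⟩ := hfg
  exact mul_ne_zero hc hg

theorem isBigO (hfg : Proportional f g) (l : Filter X) : f =O[l] g := by
  obtain ⟨c, -, rfl⟩ := hfg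
  exact isBigO_const_mul_self c g l

/-- The quotient `f / g` is continuous and takes only finitely many values. -/
theorem of_pow [TopologicalSpace X] [PreconnectedSpace X] {n : ℕ} (hn : n ≠ 0)
    (hf : Continuous f) (hg : Continuous g) (hg₀ : ∀ x, g x ≠ 0)
    (hfg : Proportional (f ^ n) (g ^ n)) : Proportional f g := by
  obtain ⟨c, hc, hfg⟩ := hfg
  have hpow (x : X) : (f x / g x) ^ n = c := by
    rw [div_pow, div_eq_iff (pow_ne_zero n (hg₀ x))]
    exact congrFun hfg x
  have hfin : {z : ℂ | z ^ n = c}.Finite :=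
    (Polynomial.nthRoots n c).toFinset.finite_toSet.subset fun z hz => by
      simpa [Polynomial.mem_nthRoots (Nat.pos_of_ne_zero hn)] using hz
  have hconst (x y : X) : f x / g x = f y / g y :=
    isPreconnected_univ.constant_of_mapsTo hfin.isDiscrete (hf.div hg hg₀).continuousOn
      (fun x _ => hpow x) (Set.mem_univ x) (Set.mem_univ y)
  rcases isEmpty_or_nonempty X with _ | ⟨⟨x₀⟩⟩
  · exact ⟨1, one_ne_zero, Subsingleton.elim _ _⟩
  refine ⟨f x₀ / g x₀, fun h => hc ?_, funext fun x => ?_⟩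
  · rw [← hpow x₀, h, zero_pow hn]
  · rw [Pi.smul_apply, smul_eq_mul, ← hconst x x₀, div_mul_cancel₀ _ (hg₀ x)]

theorem isBoundedAtImInfty {f g : ℍ → ℂ} (hfg : Proportional f g) (hg : IsBoundedAtImInfty g) :
    IsBoundedAtImInfty f :=
  (hfg.isBigO atImInfty).trans hg

theorem isZeroAtImInfty {f g : ℍ → ℂ} (hfg : Proportional f g) (hg : IsZeroAtImInfty g) :
    IsZeroAtImInfty f :=
  (hfg.isBigO atImInfty).trans_tendsto hg

end Proportional

/-! ### The slash operators -/

theorem lower_row_ne_zero (γ : SL(2, ℤ)) (τ : ℍ) :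
    ((γ 1 0 : ℤ) : ℂ) * (τ : ℂ) + ((γ 1 1 : ℤ) : ℂ) ≠ 0 := by
  simpa [denom_apply] using denom_ne_zero γ τ

theorem halfFactor_ne_zero (γ : SL(2, ℤ)) (τ : ℍ) : halfFactor γ τ ≠ 0 := fun h =>
  lower_row_ne_zero γ τ (by rw [← halfFactor_sq, h, zero_pow two_ne_zero])

theorem lower_row_mul (α β : SL(2, ℤ)) (τ : ℍ) :
    (((α * β) 1 0 : ℤ) : ℂ) * (τ : ℂ) + (((α * β) 1 1 : ℤ) : ℂ) =
      (((α 1 0 : ℤ) : ℂ) * ((β • τ : ℍ) : ℂ) + ((α 1 1 : ℤ) : ℂ)) *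
        (((β 1 0 : ℤ) : ℂ) * (τ : ℂ) + ((β 1 1 : ℤ) : ℂ)) := by
  rw [coe_specialLinearGroup_apply, Matrix.SpecialLinearGroup.coe_mul]
  simp only [Matrix.mul_apply, Fin.sum_univ_two, algebraMap_int_eq, eq_intCast,
    Complex.ofReal_intCast]
  rw [add_mul, mul_assoc, div_mul_cancel₀ _ (lower_row_ne_zero β τ)]
  push_cast
  ring

theorem mdifferentiable_of_differentiableOn {g : ℂ → ℂ}
    (hg : DifferentiableOn ℂ g upperHalfPlaneSet) :
    MDifferentiable 𝓘(ℂ) 𝓘(ℂ) (fun τ : ℍ => g τ) := by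
  rw [mdifferentiable_iff]
  refine hg.congr fun z hz => ?_
  simp [ofComplex_apply_of_im_pos hz]

theorem mdifferentiable_halfFactor (γ : SL(2, ℤ)) :
    MDifferentiable 𝓘(ℂ) 𝓘(ℂ) (halfFactor γ) := by
  refine mdifferentiable_of_differentiableOn (g := fun z => (kroneckerSymbol (γ 1 0) (γ 1 1) : ℂ) *
    (((γ 1 0 : ℤ) : ℂ) * z + ((γ 1 1 : ℤ) : ℂ)) ^ (1 / 2 : ℂ)) ?_
  rcases eq_or_ne (γ 1 0) 0 with hc | hc
  · simp only [hc, Int.cast_zero, zero_mul, zero_add]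
    fun_prop
  · intro z hz
    refine DifferentiableAt.differentiableWithinAt (.const_mul (.cpow_const (by fun_prop) ?_) _)
    exact intCast_mul_coe_add_intCast_mem_slitPlane (Or.inl hc) ⟨z, hz⟩

theorem mdifferentiable_specialLinearGroup_smul (γ : SL(2, ℤ)) :
    MDifferentiable 𝓘(ℂ) 𝓘(ℂ) (fun τ : ℍ => γ • τ) :=
  mdifferentiable_smul (g := (γ : GL (Fin 2) ℝ)) (by simp)

theorem mdifferentiable_halfSlash {k : ℕ} {f : ℍ → ℂ} (hf : MDifferentiable 𝓘(ℂ) 𝓘(ℂ) f)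
    (γ : SL(2, ℤ)) : MDifferentiable 𝓘(ℂ) 𝓘(ℂ) (halfSlash k f γ) :=
  (hf.comp (mdifferentiable_specialLinearGroup_smul γ)).div
    ((mdifferentiable_halfFactor γ).pow k) fun τ => pow_ne_zero k (halfFactor_ne_zero γ τ)

theorem halfFactor_mul (α β : SL(2, ℤ)) :
    Proportional (halfFactor (α * β)) fun τ => halfFactor α (β • τ) * halfFactor β τ := by
  refine .of_pow two_ne_zero (mdifferentiable_halfFactor _).continuous
    (((mdifferentiable_halfFactor α).comp (mdifferentiable_specialLinearGroup_smul β)).mul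
      (mdifferentiable_halfFactor β)).continuous
    (fun τ => mul_ne_zero (halfFactor_ne_zero _ _) (halfFactor_ne_zero _ _))
    ⟨1, one_ne_zero, funext fun τ => ?_⟩
  simp only [Pi.pow_apply, one_smul, mul_pow, halfFactor_sq, lower_row_mul α β τ]

theorem halfSlash_mul_right (k : ℕ) (f : ℍ → ℂ) (α β : SL(2, ℤ)) :
    Proportional (halfSlash k f (α * β)) (halfSlash k (halfSlash k f α) β) := by
  have h : halfSlash k (halfSlash k f α) β = (fun τ => f ((α * β) • τ)) /
      (fun τ => halfFactor α (β • τ) * halfFactor β τ) ^ k := by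
    ext τ
    simp only [halfSlash, Pi.div_apply, Pi.pow_apply, mul_smul, div_div, mul_pow]
  rw [h]
  exact (Proportional.refl _).div ((halfFactor_mul α β).pow k)

theorem halfSlash_div (j k : ℕ) (f g : ℍ → ℂ) (γ : SL(2, ℤ)) :
    halfSlash k (f / g) γ = halfSlash (k + j) f γ / halfSlash j g γ := by
  ext τ
  have h := halfFactor_ne_zero γ τ
  simp only [halfSlash, Pi.div_apply, pow_add]
  field_simp

theorem Proportional.halfSlash {f g : ℍ → ℂ} (h : Proportional f g) (k : ℕ) (γ : SL(2, ℤ)) :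
    Proportional (halfSlash k f γ) (halfSlash k g γ) := by
  obtain ⟨c, hc, rfl⟩ := h
  exact ⟨c, hc, halfSlash_smul k c g γ⟩

theorem halfFactor_T_zpow (n : ℤ) (τ : ℍ) : halfFactor (T ^ n) τ = 1 := by
  simp [halfFactor, coe_T_zpow, kroneckerSymbol]

theorem halfSlash_T_zpow (k : ℕ) (f : ℍ → ℂ) (n : ℤ) :
    halfSlash k f (T ^ n) = fun τ => f (T ^ n • τ) := by
  ext τ
  rw [halfSlash, halfFactor_T_zpow, one_pow, div_one]

theorem halfSlash_one_right (k : ℕ) (f : ℍ → ℂ) : halfSlash k f 1 = f := by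
  simpa using halfSlash_T_zpow k f 0

theorem halfFactor_S (τ : ℍ) : halfFactor S τ = (τ : ℂ) ^ (1 / 2 : ℂ) := by
  simp [halfFactor, kroneckerSymbol, coe_S]

theorem halfFactor_S_sq (τ : ℍ) : halfFactor (S ^ 2) τ = halfFactor (S ^ 2) I := by
  simp [halfFactor, sq, coe_S]

theorem S_sq_smul (τ : ℍ) : S ^ 2 • τ = τ := by
  have hS : (S ^ 2 : SL(2, ℤ)) = -1 := Subtype.ext (by simpa [sq] using S_mul_S_eq)
  rw [hS, SL_neg_smul, one_smul]

theorem halfSlash_S_sq (k : ℕ) (f : ℍ → ℂ) : Proportional (halfSlash k f (S ^ 2)) f := by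
  refine ⟨(halfFactor (S ^ 2) I ^ k)⁻¹, inv_ne_zero (pow_ne_zero k (halfFactor_ne_zero _ _)),
    funext fun τ => ?_⟩
  rw [halfSlash, S_sq_smul, halfFactor_S_sq, div_eq_inv_mul, Pi.smul_apply, smul_eq_mul]

/-- The subgroup of those `α` for which `f` is an eigenfunction of the slash operator of weight
`k/2`, with a nonzero eigenvalue. -/
noncomputable def slashStabilizer (k : ℕ) (f : ℍ → ℂ) : Subgroup SL(2, ℤ) where
  carrier := {α | Proportional (halfSlash k f α) f}
  one_mem' := by
    rw [Set.mem_ofPred_eq, halfSlash_one_right]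
    exact .refl f
  mul_mem' {α β} hα hβ := (halfSlash_mul_right k f α β).trans ((hα.halfSlash k β).trans hβ)
  inv_mem' {α} hα := by
    have h := halfSlash_mul_right k f α α⁻¹
    rw [mul_inv_cancel, halfSlash_one_right] at h
    exact (h.trans (hα.halfSlash k α⁻¹)).symm

theorem mem_slashStabilizer {k : ℕ} {f : ℍ → ℂ} {α : SL(2, ℤ)} :
    α ∈ slashStabilizer k f ↔ Proportional (halfSlash k f α) f :=
  Iff.rfl

/-! ### The even and odd theta functions -/

theorem hasSum_add_of_isCompl_range {α β γ : Type*} {f : γ → ℂ} {φ : α → γ} {ψ : β → γ}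
    (hφ : φ.Injective) (hψ : ψ.Injective) (h : IsCompl (Set.range φ) (Set.range ψ)) {a b : ℂ}
    (ha : HasSum (f ∘ φ) a) (hb : HasSum (f ∘ ψ) b) : HasSum f (a + b) :=
  (hφ.hasSum_range_iff.mpr ha).add_isCompl h (hψ.hasSum_range_iff.mpr hb)

theorem hasSum_theta {z : ℂ} (hz : 0 < z.im) :
    HasSum (fun n : ℤ => Complex.exp (2 * Real.pi * Complex.I * (n : ℂ) ^ 2 * z)) (theta z) := by
  have hsum := (summable_jacobiTheta₂_term_iff 0 (2 * z)).mpr (by simpa using hz)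
  refine (hsum.congr fun n => ?_).hasSum
  rw [jacobiTheta₂_term]
  congr 1
  ring

theorem differentiableAt_theta {z : ℂ} (hz : 0 < z.im) : DifferentiableAt ℂ theta z := by
  rw [show theta = jacobiTheta ∘ (fun z => 2 * z) from funext theta_eq_jacobiTheta]
  exact (differentiableAt_jacobiTheta (by simpa using hz)).comp z (by fun_prop)

/-- The theta function `θ(τ)` on the upper half-plane: the sum over the even integers in
`θ(τ/4)`. -/
noncomputable def thetaEven (τ : ℍ) : ℂ := theta τ

/-- The theta function `θ(τ/4) - θ(τ)`: the sum over the odd integers in `θ(τ/4)`. -/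
noncomputable def thetaOdd (τ : ℍ) : ℂ := theta ((τ : ℂ) / 4) - theta τ

theorem hasSum_thetaEven (τ : ℍ) :
    HasSum (fun n : ℤ => Complex.exp (2 * Real.pi * Complex.I * (n : ℂ) ^ 2 * τ))
      (thetaEven τ) :=
  hasSum_theta τ.im_pos

theorem hasSum_thetaOdd (τ : ℍ) :
    HasSum (fun n : ℤ => Complex.exp (2 * Real.pi * Complex.I * ((n : ℂ) + 1 / 2) ^ 2 * τ))
      (thetaOdd τ) := by
  have heven : Function.Injective fun n : ℤ => 2 * n := fun m n h => by simpa using h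
  have hodd : Function.Injective fun n : ℤ => 2 * n + 1 := fun m n h => by simpa using h
  have hcompl : IsCompl (Set.range fun n : ℤ => 2 * n) (Set.range fun n : ℤ => 2 * n + 1) := by
    rw [range_two_mul, range_two_mul_add_one]
    exact Int.isCompl_even_odd
  have hfull := hasSum_theta (z := (τ : ℂ) / 4) (by simpa using τ.im_pos)
  have hsum := hasSum_add_of_isCompl_range heven hodd hcompl
    ((hasSum_thetaEven τ).congr_fun fun n => ?_) (hfull.summable.comp_injective hodd).hasSum
  · rw [thetaOdd, hfull.unique hsum, thetaEven, add_sub_cancel_left]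
    refine (hfull.summable.comp_injective hodd).hasSum.congr_fun fun n => ?_
    simp only [Function.comp_apply]
    congr 1
    push_cast
    ring
  · simp only [Function.comp_apply]
    congr 1
    push_cast
    ring

theorem mdifferentiable_thetaEven : MDifferentiable 𝓘(ℂ) 𝓘(ℂ) thetaEven :=
  mdifferentiable_of_differentiableOn fun _ hz => (differentiableAt_theta hz).differentiableWithinAt

theorem mdifferentiable_thetaOdd : MDifferentiable 𝓘(ℂ) 𝓘(ℂ) thetaOdd := by
  refine mdifferentiable_of_differentiableOn (g := fun z => theta (z / 4) - theta z) fun z hz => ?_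
  refine DifferentiableAt.differentiableWithinAt (.sub ?_ (differentiableAt_theta hz))
  exact (differentiableAt_theta (by simpa using hz)).comp (f := fun z : ℂ => z / 4) z (by fun_prop)

theorem thetaEven_T_zpow_smul (n : ℤ) (τ : ℍ) : thetaEven (T ^ n • τ) = thetaEven τ := by
  induction n generalizing τ with
  | zero => simp
  | succ n ih => rw [zpow_add, mul_smul, ih, zpow_one]; exact theta_T_smul τ
  | pred n ih =>
    rw [zpow_sub, mul_smul, ih, zpow_one]
    exact (theta_T_smul (T⁻¹ • τ)).symm.trans (by rw [smul_inv_smul]; rfl)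

/-- `(n + 1/2)² = n(n+1) + 1/4` is congruent to `1/4` modulo `1`. -/
theorem thetaOdd_T_smul (τ : ℍ) : thetaOdd (T • τ) = Complex.I * thetaOdd τ := by
  rw [← Complex.exp_pi_div_two_mul_I]
  refine (hasSum_thetaOdd (T • τ)).unique (((hasSum_thetaOdd τ).mul_left _).congr_fun fun n => ?_)
  rw [modular_T_smul, coe_vadd, ← Complex.exp_add, Complex.exp_eq_exp_iff_exists_int]
  refine ⟨n * (n + 1), ?_⟩
  push_cast
  ring

theorem thetaOdd_T_zpow_smul (n : ℤ) (τ : ℍ) :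
    thetaOdd (T ^ n • τ) = Complex.I ^ n * thetaOdd τ := by
  have hI := Complex.I_ne_zero
  induction n generalizing τ with
  | zero => simp
  | succ n ih =>
    rw [zpow_add, mul_smul, ih, zpow_one, thetaOdd_T_smul, zpow_add₀ hI, zpow_one, mul_assoc]
  | pred n ih =>
    have h := thetaOdd_T_smul (T⁻¹ • τ)
    rw [smul_inv_smul] at h
    rw [zpow_sub, mul_smul, ih, zpow_one, h, zpow_sub₀ hI, zpow_one, ← mul_assoc,
      div_mul_cancel₀ _ hI]

theorem sqrt_neg_two_I_mul {r : ℝ} (hr : 0 < r) (τ : ℍ) :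
    (-2 * Complex.I * ((r : ℂ) ^ 2 * τ)) ^ (1 / 2 : ℂ) =
      (1 - Complex.I) * r * (τ : ℂ) ^ (1 / 2 : ℂ) := by
  refine (eq_sqrt_of_sq_eq ?_ ?_).symm
  · rw [mul_pow, sqrt_sq, mul_pow, sub_sq, Complex.I_sq]
    ring
  · have hre := sqrt_re_pos (z := τ) (Or.inr τ.im_ne_zero)
    have him := sqrt_im_pos (z := τ) τ.im_pos
    rw [mul_comm (1 - Complex.I), mul_assoc, Complex.re_ofReal_mul]
    refine mul_pos hr ?_
    simp only [Complex.mul_re, Complex.sub_re, Complex.one_re, Complex.I_re, Complex.sub_im,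
      Complex.one_im, Complex.I_im]
    linarith

theorem thetaEven_S_smul (τ : ℍ) : thetaEven (S • τ) =
    (1 - Complex.I) / 2 * (τ : ℂ) ^ (1 / 2 : ℂ) * (thetaEven τ + thetaOdd τ) := by
  have h := theta_neg_inv (τ := (τ : ℂ) / 4) (by simpa using τ.im_pos)
  have hsqrt := sqrt_neg_two_I_mul (r := 1 / 2) one_half_pos τ
  have hS : -1 / (4 * ((τ : ℂ) / 4)) = (S • τ : ℍ) := by
    rw [modular_S_smul, show 4 * ((τ : ℂ) / 4) = τ by ring, neg_div, one_div, ← inv_neg]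
  push_cast at hsqrt
  rw [hS, show (τ : ℂ) / 4 = (1 / 2) ^ 2 * τ by ring, hsqrt] at h
  rw [thetaEven, h, thetaEven, thetaOdd, add_sub_cancel]
  ring_nf

theorem thetaOdd_S_smul (τ : ℍ) : thetaOdd (S • τ) =
    (1 - Complex.I) / 2 * (τ : ℂ) ^ (1 / 2 : ℂ) * (thetaEven τ - thetaOdd τ) := by
  have h := theta_neg_inv τ.im_pos
  have hsqrt := sqrt_neg_two_I_mul one_pos τ
  have hS : -1 / (4 * (τ : ℂ)) = ((S • τ : ℍ) : ℂ) / 4 := by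
    rw [modular_S_smul, mul_comm, ← div_div, neg_div, one_div, ← inv_neg]
  rw [Complex.ofReal_one, one_pow, one_mul, mul_one] at hsqrt
  rw [hS, hsqrt] at h
  have hE : theta (S • τ : ℍ) = _ := thetaEven_S_smul τ
  rw [thetaOdd, h, hE, thetaEven]
  ring

theorem tendsto_ofReal_mul_coe_atImInfty {r : ℝ} (hr : 0 < r) :
    Tendsto (fun τ : ℍ => (r : ℂ) * (τ : ℂ)) atImInfty (comap Complex.im atTop) := by
  rw [tendsto_comap_iff]
  simpa only [Function.comp_def, Complex.im_ofReal_mul, coe_im] using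
    Tendsto.const_mul_atTop (l := atImInfty) hr tendsto_comap

theorem tendsto_jacobiTheta : Tendsto jacobiTheta (comap Complex.im atTop) (𝓝 1) := by
  have h : Tendsto (fun τ : ℂ => Real.exp (-Real.pi * τ.im)) (comap Complex.im atTop) (𝓝 0) :=
    Real.tendsto_exp_atBot.comp
      (tendsto_comap.const_mul_atTop_of_neg (neg_lt_zero.mpr Real.pi_pos))
  simpa using (isBigO_at_im_infty_jacobiTheta_sub_one.trans_tendsto h).add_const 1

theorem tendsto_thetaEven : Tendsto thetaEven atImInfty (𝓝 1) := by
  refine (tendsto_jacobiTheta.comp (tendsto_ofReal_mul_coe_atImInfty two_pos)).congr fun τ => ?_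
  simp [thetaEven, theta_eq_jacobiTheta]

theorem tendsto_thetaOdd : Tendsto thetaOdd atImInfty (𝓝 0) := by
  have h := (tendsto_jacobiTheta.comp
    (tendsto_ofReal_mul_coe_atImInfty one_half_pos)).sub tendsto_thetaEven
  rw [sub_self] at h
  refine h.congr fun τ => ?_
  rw [thetaOdd, thetaEven, theta_eq_jacobiTheta ((τ : ℂ) / 4), Function.comp_apply]
  congr 2
  push_cast
  ring

/-! ### The space spanned by the theta functions -/

theorem Proportional.mem {X : Type*} {f g : X → ℂ} {V : Submodule ℂ (X → ℂ)}
    (hfg : Proportional f g) (hg : g ∈ V) : f ∈ V := by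
  obtain ⟨c, -, rfl⟩ := hfg
  exact V.smul_mem c hg

/-- The space spanned by `θ(τ)` and `θ(τ/4)`, which will turn out to be the space of all modular
forms of weight `1/2`. -/
noncomputable def thetaSpace : Submodule ℂ (ℍ → ℂ) := Submodule.span ℂ {thetaEven, thetaOdd}

theorem mem_thetaSpace {f : ℍ → ℂ} :
    f ∈ thetaSpace ↔ ∃ a b : ℂ, a • thetaEven + b • thetaOdd = f :=
  Submodule.mem_span_pair

theorem thetaEven_mem_thetaSpace : thetaEven ∈ thetaSpace :=
  Submodule.subset_span (Set.mem_insert _ _)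

theorem thetaOdd_mem_thetaSpace : thetaOdd ∈ thetaSpace :=
  Submodule.subset_span (Set.mem_insert_of_mem _ rfl)

theorem tendsto_linear_combination_theta (a b : ℂ) :
    Tendsto (a • thetaEven + b • thetaOdd) atImInfty (𝓝 a) := by
  have h := (tendsto_thetaEven.const_mul a).add (tendsto_thetaOdd.const_mul b)
  rwa [mul_one, mul_zero, add_zero] at h

theorem isBoundedAtImInfty_of_mem_thetaSpace {f : ℍ → ℂ} (hf : f ∈ thetaSpace) :
    IsBoundedAtImInfty f := by
  obtain ⟨a, b, rfl⟩ := mem_thetaSpace.mp hf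
  exact (tendsto_linear_combination_theta a b).isBigO_one ℝ

theorem halfSlash_thetaEven_T_zpow (n : ℤ) : halfSlash 1 thetaEven (T ^ n) = thetaEven := by
  rw [halfSlash_T_zpow]
  exact funext (thetaEven_T_zpow_smul n)

theorem halfSlash_thetaOdd_T_zpow (n : ℤ) :
    halfSlash 1 thetaOdd (T ^ n) = Complex.I ^ n • thetaOdd := by
  rw [halfSlash_T_zpow]
  exact funext (thetaOdd_T_zpow_smul n)

theorem halfSlash_thetaEven_S :
    halfSlash 1 thetaEven S = ((1 - Complex.I) / 2) • (thetaEven + thetaOdd) := by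
  ext τ
  rw [halfSlash, halfFactor_S, thetaEven_S_smul, pow_one, mul_right_comm,
    mul_div_cancel_right₀ _ (sqrt_ne_zero τ.ne_zero)]
  rfl

theorem halfSlash_thetaOdd_S :
    halfSlash 1 thetaOdd S = ((1 - Complex.I) / 2) • (thetaEven - thetaOdd) := by
  ext τ
  rw [halfSlash, halfFactor_S, thetaOdd_S_smul, pow_one, mul_right_comm,
    mul_div_cancel_right₀ _ (sqrt_ne_zero τ.ne_zero)]
  rfl

theorem halfSlash_mem_thetaSpace_of_generators {α : SL(2, ℤ)}
    (hE : halfSlash 1 thetaEven α ∈ thetaSpace) (hO : halfSlash 1 thetaOdd α ∈ thetaSpace)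
    {f : ℍ → ℂ} (hf : f ∈ thetaSpace) : halfSlash 1 f α ∈ thetaSpace := by
  obtain ⟨a, b, rfl⟩ := mem_thetaSpace.mp hf
  rw [halfSlash_add, halfSlash_smul, halfSlash_smul]
  exact thetaSpace.add_mem (thetaSpace.smul_mem a hE) (thetaSpace.smul_mem b hO)

theorem halfSlash_T_zpow_mem_thetaSpace (n : ℤ) {f : ℍ → ℂ} (hf : f ∈ thetaSpace) :
    halfSlash 1 f (T ^ n) ∈ thetaSpace := by
  refine halfSlash_mem_thetaSpace_of_generators ?_ ?_ hf
  · rw [halfSlash_thetaEven_T_zpow]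
    exact thetaEven_mem_thetaSpace
  · rw [halfSlash_thetaOdd_T_zpow]
    exact thetaSpace.smul_mem _ thetaOdd_mem_thetaSpace

theorem halfSlash_S_mem_thetaSpace {f : ℍ → ℂ} (hf : f ∈ thetaSpace) :
    halfSlash 1 f S ∈ thetaSpace := by
  have hE := thetaEven_mem_thetaSpace
  have hO := thetaOdd_mem_thetaSpace
  refine halfSlash_mem_thetaSpace_of_generators ?_ ?_ hf
  · rw [halfSlash_thetaEven_S]
    exact thetaSpace.smul_mem _ (thetaSpace.add_mem hE hO)
  · rw [halfSlash_thetaOdd_S]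
    exact thetaSpace.smul_mem _ (thetaSpace.sub_mem hE hO)

theorem halfSlash_S_inv (k : ℕ) (f : ℍ → ℂ) :
    Proportional (halfSlash k f S⁻¹) (halfSlash k f S) := by
  have hS : (S⁻¹ : SL(2, ℤ)) = S ^ 2 * S := by decide
  rw [hS]
  exact (halfSlash_mul_right k f _ _).trans ((halfSlash_S_sq k f).halfSlash k S)

theorem halfSlash_mem_thetaSpace (α : SL(2, ℤ)) {f : ℍ → ℂ} (hf : f ∈ thetaSpace) :
    halfSlash 1 f α ∈ thetaSpace := by
  have hα : α ∈ Subgroup.closure {S, T} := by simp [SpecialLinearGroup.SL2Z_generators]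
  induction hα using Subgroup.closure_induction_right with
  | one => rwa [halfSlash_one_right]
  | mul_right β _ γ hγ hβ =>
    refine (halfSlash_mul_right 1 f β γ).mem ?_
    rcases hγ with rfl | rfl
    · exact halfSlash_S_mem_thetaSpace hβ
    · simpa using halfSlash_T_zpow_mem_thetaSpace 1 hβ
  | mul_inv_cancel β _ γ hγ hβ =>
    refine (halfSlash_mul_right 1 f β γ⁻¹).mem ?_
    rcases hγ with rfl | rfl
    · exact (halfSlash_S_inv 1 _).mem (halfSlash_S_mem_thetaSpace hβ)
    · simpa using halfSlash_T_zpow_mem_thetaSpace (-1) hβ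

theorem mem_Gamma1_four_and_dvd_of_mem_Gamma_four {γ : SL(2, ℤ)} (hγ : γ ∈ Gamma 4) :
    γ ∈ Gamma1 4 ∧ 4 ∣ γ 0 1 := by
  obtain ⟨ha, hb, hc, hd⟩ := Gamma_mem.mp hγ
  exact ⟨(Gamma1_mem 4 γ).mpr ⟨ha, hd, hc⟩, (ZMod.intCast_zmod_eq_zero_iff_dvd _ 4).mp hb⟩

theorem halfSlash_thetaEven_of_mem_Gamma1_four {γ : SL(2, ℤ)} (hγ : γ ∈ Gamma1 4) :
    halfSlash 1 thetaEven γ = thetaEven := by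
  ext τ
  rw [halfSlash, thetaEven, theta_smul hγ, pow_one,
    mul_div_cancel_left₀ _ (halfFactor_ne_zero γ τ), thetaEven]

theorem halfSlash_thetaOdd_of_mem_Gamma_four {γ : SL(2, ℤ)} (hγ : γ ∈ Gamma 4) :
    halfSlash 1 thetaOdd γ = thetaOdd := by
  obtain ⟨hγ', hb⟩ := mem_Gamma1_four_and_dvd_of_mem_Gamma_four hγ
  ext τ
  rw [halfSlash, thetaOdd, theta_smul_div_four hγ' hb, theta_smul hγ', pow_one, ← mul_sub,
    mul_div_cancel_left₀ _ (halfFactor_ne_zero γ τ), thetaOdd]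

theorem thetaEven_mem_modForms : thetaEven ∈ modForms (Gamma 4) 1 :=
  ⟨mdifferentiable_thetaEven, fun _ hγ =>
    halfSlash_thetaEven_of_mem_Gamma1_four (mem_Gamma1_four_and_dvd_of_mem_Gamma_four hγ).1,
    fun α => isBoundedAtImInfty_of_mem_thetaSpace
      (halfSlash_mem_thetaSpace α thetaEven_mem_thetaSpace)⟩

theorem thetaOdd_mem_modForms : thetaOdd ∈ modForms (Gamma 4) 1 :=
  ⟨mdifferentiable_thetaOdd, fun _ hγ => halfSlash_thetaOdd_of_mem_Gamma_four hγ,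
    fun α => isBoundedAtImInfty_of_mem_thetaSpace
      (halfSlash_mem_thetaSpace α thetaOdd_mem_thetaSpace)⟩

theorem thetaSpace_le_modForms : thetaSpace ≤ modForms (Gamma 4) 1 :=
  Submodule.span_le.mpr (Set.pair_subset thetaEven_mem_modForms thetaOdd_mem_modForms)

/-! ### The product of the theta functions vanishing at the cusps -/

/-- The product of `θ(τ)`, `θ(τ/4) - θ(τ)` and the four combinations `θ(τ) - a (θ(τ/4) - θ(τ))`
with `a⁴ = 1`: one theta function vanishing at each of the six cusps of `Γ(4)`. -/
noncomputable def thetaProd : ℍ → ℂ := thetaEven * thetaOdd * (thetaEven ^ 4 - thetaOdd ^ 4)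

theorem thetaProd_mem_modForms : thetaProd ∈ modForms (Gamma 4) 6 :=
  SetLike.mul_mem_graded (i := 2) (j := 4)
    (SetLike.mul_mem_graded (i := 1) (j := 1) thetaEven_mem_modForms thetaOdd_mem_modForms)
    (Submodule.sub_mem _ (SetLike.pow_mem_graded 4 thetaEven_mem_modForms)
      (SetLike.pow_mem_graded 4 thetaOdd_mem_modForms))

theorem thetaProd_T_smul (τ : ℍ) : thetaProd (T • τ) = Complex.I * thetaProd τ := by
  have hE := thetaEven_T_zpow_smul 1 τ
  rw [zpow_one] at hE
  simp only [thetaProd, Pi.mul_apply, Pi.sub_apply, Pi.pow_apply, hE, thetaOdd_T_smul,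
    mul_pow, Complex.I_pow_four]
  ring

theorem thetaProd_S_smul (τ : ℍ) : thetaProd (S • τ) = Complex.I * (τ : ℂ) ^ 3 * thetaProd τ := by
  have hsq : ((1 - Complex.I) / 2) ^ 2 = -Complex.I / 2 := by
    linear_combination 1 / 4 * Complex.I_sq
  have hI : ((1 - Complex.I) / 2) ^ 6 = Complex.I / 8 := by
    rw [pow_mul _ 2 3, hsq]
    linear_combination -Complex.I / 8 * Complex.I_sq
  have hτ : (τ : ℂ) ^ 3 = ((τ : ℂ) ^ (1 / 2 : ℂ)) ^ 6 := by rw [pow_mul _ 2 3, sqrt_sq]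
  simp only [thetaProd, Pi.mul_apply, Pi.sub_apply, Pi.pow_apply, thetaEven_S_smul, thetaOdd_S_smul]
  rw [hτ]
  linear_combination (8 * ((τ : ℂ) ^ (1 / 2 : ℂ)) ^ 6 * thetaEven τ * thetaOdd τ *
    (thetaEven τ ^ 4 - thetaOdd τ ^ 4)) * hI

theorem ne_zero_of_tendsto_one {f : ℍ → ℂ} (hf : Tendsto f atImInfty (𝓝 1)) : f ≠ 0 := by
  rintro rfl
  exact zero_ne_one (tendsto_nhds_unique tendsto_const_nhds hf)

theorem tendsto_thetaEven_pow_sub_thetaOdd_pow :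
    Tendsto (thetaEven ^ 4 - thetaOdd ^ 4) atImInfty (𝓝 1) := by
  have h := (tendsto_thetaEven.pow 4).sub (tendsto_thetaOdd.pow 4)
  rwa [one_pow, zero_pow four_ne_zero, sub_zero] at h

theorem isZeroAtImInfty_thetaProd : IsZeroAtImInfty thetaProd := by
  have h := (tendsto_thetaEven.mul tendsto_thetaOdd).mul tendsto_thetaEven_pow_sub_thetaOdd_pow
  rwa [mul_zero, zero_mul] at h

theorem thetaOdd_ne_zero : thetaOdd ≠ 0 := by
  intro h
  have hS := halfSlash_thetaOdd_S
  have hzero : halfSlash 1 (0 : ℍ → ℂ) S = 0 := funext fun τ => zero_div _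
  have hI : (1 - Complex.I) / 2 ≠ 0 := fun hI => by simpa using congrArg Complex.re hI
  rw [h, hzero, sub_zero, eq_comm, smul_eq_zero_iff_right hI] at hS
  exact ne_zero_of_tendsto_one tendsto_thetaEven hS

theorem thetaProd_ne_zero : thetaProd ≠ 0 := by
  have hE := mdifferentiable_thetaEven
  have hO := mdifferentiable_thetaOdd
  rw [thetaProd, ne_eq, UpperHalfPlane.mul_eq_zero_iff (hE.mul hO) ((hE.pow 4).sub (hO.pow 4)),
    UpperHalfPlane.mul_eq_zero_iff hE hO]
  exact not_or.mpr ⟨not_or.mpr ⟨ne_zero_of_tendsto_one tendsto_thetaEven, thetaOdd_ne_zero⟩,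
    ne_zero_of_tendsto_one tendsto_thetaEven_pow_sub_thetaOdd_pow⟩

open scoped ModularForm in
theorem thetaProd_pow_four_slash (γ : SL(2, ℤ)) :
    (thetaProd ^ 4) ∣[(12 : ℤ)] γ = thetaProd ^ 4 := by
  refine SlashInvariantForm.slash_action_generators_SL2Z (funext fun τ => ?_)
    (funext fun τ => ?_) γ
  · have hτ := τ.ne_zero
    rw [ModularForm.SL_slash_apply, denom_S, Pi.pow_apply, Pi.pow_apply, thetaProd_S_smul, mul_pow,
      mul_pow, Complex.I_pow_four, one_mul, ← pow_mul, zpow_neg,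
      mul_comm ((τ : ℂ) ^ _)]
    exact mul_inv_cancel_right₀ (pow_ne_zero 12 hτ) _
  · have hden : denom T τ = 1 := by rw [ModularGroup.denom_apply, coe_T]; simp
    rw [ModularForm.SL_slash_apply, Pi.pow_apply, Pi.pow_apply, thetaProd_T_smul, mul_pow,
      Complex.I_pow_four, one_mul]
    rw [hden, one_zpow, mul_one]

/-- The fourth power of `thetaProd`, as a cusp form of weight `12` and level `1`. -/
noncomputable def thetaProdPowFour : CuspForm 𝒮ℒ 12 where
  toFun := thetaProd ^ 4
  slash_action_eq' := by
    rintro _ ⟨γ, rfl⟩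
    exact thetaProd_pow_four_slash γ
  holo' := thetaProd_mem_modForms.1.pow 4
  zero_at_cusps' hc := by
    rw [Subgroup.IsArithmetic.isCusp_iff_isCusp_SL2Z] at hc
    rw [OnePoint.isZeroAt_iff_forall_SL2Z hc]
    intro γ _
    rw [thetaProd_pow_four_slash]
    exact (isZeroAtImInfty_thetaProd.pow 4).trans (by simp)

/-- The cusp form `η⁶` of weight `3`. -/
noncomputable def etaSix (τ : ℍ) : ℂ := ModularForm.eta τ ^ 6

theorem etaSix_ne_zero (τ : ℍ) : etaSix τ ≠ 0 := pow_ne_zero 6 (ModularForm.eta_ne_zero τ.im_pos)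

theorem mdifferentiable_etaSix : MDifferentiable 𝓘(ℂ) 𝓘(ℂ) etaSix :=
  mdifferentiable_of_differentiableOn (g := fun z => ModularForm.eta z ^ 6) fun _ hz =>
    ((ModularForm.differentiableAt_eta_of_mem_upperHalfPlaneSet hz).pow 6).differentiableWithinAt

theorem etaSix_pow_four : etaSix ^ 4 = ModularForm.discriminant :=
  funext fun τ => (pow_mul (ModularForm.eta τ) 6 4).symm

theorem thetaProd_proportional_etaSix : Proportional thetaProd etaSix := by
  obtain ⟨c, hc⟩ := CuspForm.exists_smul_discriminant_of_weight_eq_twelve thetaProdPowFour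
  have hpow : thetaProd ^ 4 = c • etaSix ^ 4 := by
    rw [etaSix_pow_four]
    exact (congrArg DFunLike.coe hc).symm
  refine Proportional.of_pow four_ne_zero thetaProd_mem_modForms.1.continuous
    mdifferentiable_etaSix.continuous etaSix_ne_zero ⟨c, ?_, hpow⟩
  rintro rfl
  rw [zero_smul, pow_eq_zero_iff four_ne_zero] at hpow
  exact thetaProd_ne_zero hpow

theorem etaSix_mem_modForms : etaSix ∈ modForms (Gamma 4) 6 :=
  thetaProd_proportional_etaSix.symm.mem thetaProd_mem_modForms

theorem thetaProd_apply_ne_zero (τ : ℍ) : thetaProd τ ≠ 0 :=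
  thetaProd_proportional_etaSix.ne_zero (etaSix_ne_zero τ)

theorem thetaEven_apply_ne_zero (τ : ℍ) : thetaEven τ ≠ 0 := fun h =>
  thetaProd_apply_ne_zero τ (by simp [thetaProd, h])

theorem thetaOdd_apply_ne_zero (τ : ℍ) : thetaOdd τ ≠ 0 := fun h =>
  thetaProd_apply_ne_zero τ (by simp [thetaProd, h])

theorem slashStabilizer_etaSix : slashStabilizer 6 etaSix = ⊤ := by
  have hT : Proportional (halfSlash 6 thetaProd T) thetaProd := by
    refine ⟨Complex.I, Complex.I_ne_zero, ?_⟩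
    rw [← zpow_one T, halfSlash_T_zpow, zpow_one]
    exact funext thetaProd_T_smul
  have hS : Proportional (halfSlash 6 thetaProd S) thetaProd := by
    refine ⟨Complex.I, Complex.I_ne_zero, funext fun τ => ?_⟩
    rw [halfSlash, thetaProd_S_smul, halfFactor_S, pow_mul _ 2 3, sqrt_sq, mul_right_comm]
    exact mul_div_cancel_right₀ _ (pow_ne_zero 3 τ.ne_zero)
  have hη := thetaProd_proportional_etaSix
  rw [eq_top_iff, ← SpecialLinearGroup.SL2Z_generators, Subgroup.closure_le]
  rintro _ (rfl | rfl)
  · exact ((hη.symm.halfSlash 6 S).trans hS).trans hη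
  · exact ((hη.symm.halfSlash 6 T).trans hT).trans hη

/-- The parameter `e ^ (-π y / 2)` at the cusps of `Γ(4)`, whose width is `4`. -/
noncomputable def cuspDecay (τ : ℍ) : ℝ := Real.exp (-2 * Real.pi * τ.im / 4)

theorem cuspDecay_isBigO_etaSix : cuspDecay =O[atImInfty] etaSix := by
  refine IsBigO.of_pow four_ne_zero ?_
  rw [etaSix_pow_four]
  refine ModularForm.exp_isBigO_discriminant.congr_left fun τ => ?_
  rw [Pi.pow_apply, cuspDecay, ← Real.exp_nat_mul]
  congr 1
  push_cast
  ring

theorem cuspDecay_isBigO_thetaOdd : cuspDecay =O[atImInfty] thetaOdd := by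
  have h : (thetaEven * (thetaEven ^ 4 - thetaOdd ^ 4)) =O[atImInfty] (1 : ℍ → ℝ) :=
    (tendsto_thetaEven.mul tendsto_thetaEven_pow_sub_thetaOdd_pow).isBigO_one ℝ
  have hP : thetaProd =O[atImInfty] thetaOdd := by
    have hO := (isBigO_refl thetaOdd atImInfty).norm_right.mul h
    refine (hO.congr (fun τ => ?_) fun τ => mul_one ‖thetaOdd τ‖).of_norm_right
    exact (mul_left_comm _ _ _).trans (mul_assoc _ _ _).symm
  exact (cuspDecay_isBigO_etaSix.trans
    (thetaProd_proportional_etaSix.symm.isBigO atImInfty)).trans hP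

/-! ### Behaviour of modular forms at the cusps -/

/-- Writing `f = h * θ ^ k` reduces the claim to weight `0`, where the slash operators form an
action, and to `θ`, whose images under the slash operators lie in `thetaSpace`. -/
theorem halfSlash_mem_modForms {k : ℕ} {f : ℍ → ℂ} (hf : f ∈ modForms (Gamma 4) k)
    (β : SL(2, ℤ)) : halfSlash k f β ∈ modForms (Gamma 4) k := by
  have hE := thetaEven_mem_modForms
  have hE₀ (τ : ℍ) : thetaEven τ ^ k ≠ 0 := pow_ne_zero k (thetaEven_apply_ne_zero τ)
  obtain ⟨h, rfl⟩ : ∃ h : ℍ → ℂ, f = h * thetaEven ^ k :=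
    ⟨f / thetaEven ^ k, funext fun τ => (div_mul_cancel₀ _ (hE₀ τ)).symm⟩
  have hslash (g : ℍ → ℂ) (j : ℍ → ℂ) (γ : SL(2, ℤ)) :
      halfSlash k (g * j ^ k) γ = (fun τ => g (γ • τ)) * halfSlash 1 j γ ^ k := by
    ext τ
    simp only [halfSlash, Pi.mul_apply, Pi.pow_apply, pow_one, div_pow, mul_div_assoc]
  have hinv (γ : SL(2, ℤ)) (hγ : γ ∈ Gamma 4) (τ : ℍ) : h (γ • τ) = h τ := by
    have hfγ := congrFun (hf.2.1 γ hγ) τ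
    rw [hslash, hE.2.1 γ hγ] at hfγ
    exact mul_right_cancel₀ (hE₀ τ) hfγ
  refine ⟨mdifferentiable_halfSlash hf.1 β, fun γ hγ => ?_, fun α =>
    (halfSlash_mul_right k _ β α).symm.isBoundedAtImInfty (hf.2.2 (β * α))⟩
  have hEβ := thetaSpace_le_modForms (halfSlash_mem_thetaSpace β thetaEven_mem_thetaSpace)
  rw [hslash, hslash, hEβ.2.1 γ hγ]
  congr 1
  ext τ
  rw [← hinv _ ((Gamma_normal 4).conj_mem γ hγ β) (β • τ), smul_smul, smul_smul,
    inv_mul_cancel_right]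

theorem T_zpow_four_mem_Gamma_four : T ^ (4 : ℤ) ∈ Gamma 4 := by
  rw [Gamma_mem, coe_T_zpow]
  exact ⟨rfl, rfl, rfl, rfl⟩

theorem periodic_comp_ofComplex {k : ℕ} {f : ℍ → ℂ} (hf : f ∈ modForms (Gamma 4) k) :
    Function.Periodic (f ∘ ofComplex) ((4 : ℝ) : ℂ) := by
  have hper (τ : ℍ) : f (T ^ (4 : ℤ) • τ) = f τ := by
    have h := hf.2.1 _ T_zpow_four_mem_Gamma_four
    rw [halfSlash_T_zpow] at h
    exact congrFun h τ
  intro z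
  rw [Function.comp_apply, Function.comp_apply]
  rcases le_or_gt z.im 0 with hz | hz
  · rw [ofComplex_apply_of_im_nonpos hz, ofComplex_apply_of_im_nonpos (by simpa using hz)]
  · rw [← hper (ofComplex z), ofComplex_apply_of_im_pos hz,
      ofComplex_apply_of_im_pos (by simpa using hz), modular_T_zpow_smul]
    congr 1
    ext
    simp [coe_vadd, add_comm]

theorem isBigO_cuspDecay {k : ℕ} {f : ℍ → ℂ} (hf : f ∈ modForms (Gamma 4) k)
    (hf₀ : IsZeroAtImInfty f) : f =O[atImInfty] cuspDecay :=
  hf₀.exp_decay_atImInfty four_pos (periodic_comp_ofComplex hf) hf.1 hf₀.isBoundedAtImInfty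

theorem tendsto_cuspDecay : Tendsto cuspDecay atImInfty (𝓝 0) :=
  Real.tendsto_exp_atBot.comp <| Tendsto.atBot_div_const four_pos <|
    tendsto_comap.const_mul_atTop_of_neg (by linarith [Real.pi_pos])

theorem exists_tendsto_atImInfty {k : ℕ} {f : ℍ → ℂ} (hf : f ∈ modForms (Gamma 4) k) :
    ∃ c, Tendsto f atImInfty (𝓝 c) := by
  have hbdd : IsBoundedAtImInfty f := halfSlash_one_right k f ▸ hf.2.2 1
  have h := exp_decay_sub_atImInfty four_pos (periodic_comp_ofComplex hf) hf.1 hbdd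
  exact ⟨_, tendsto_sub_nhds_zero_iff.mp (h.trans_tendsto tendsto_cuspDecay)⟩

theorem div_mem_modForms {Γ : Subgroup SL(2, ℤ)} {j k : ℕ} {f g : ℍ → ℂ}
    (hf : f ∈ modForms Γ (k + j)) (hg : g ∈ modForms Γ j) (hg₀ : ∀ τ, g τ ≠ 0)
    (hfg : ∀ α, halfSlash (k + j) f α =O[atImInfty] halfSlash j g α) :
    f / g ∈ modForms Γ k := by
  refine ⟨hf.1.div hg.1 hg₀, fun γ hγ => ?_, fun α => ?_⟩
  · rw [halfSlash_div j, hf.2.1 γ hγ, hg.2.1 γ hγ]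
  · rw [halfSlash_div j]
    exact (isBigO_one_iff ℝ).mpr (div_isBoundedUnder_of_isBigO (hfg α))

/-! ### Division by the odd theta function -/

theorem tendsto_T_zpow_smul_atImInfty (n : ℤ) :
    Tendsto (fun τ : ℍ => T ^ n • τ) atImInfty atImInfty :=
  tendsto_comap_iff.mpr <| tendsto_comap.congr fun τ => (im_T_zpow_smul τ n).symm

theorem mem_Gamma1_four_or_mul_S_sq_mem {δ : SL(2, ℤ)} (hδ : 4 ∣ δ 1 0) :
    δ ∈ Gamma1 4 ∨ δ * S ^ 2 ∈ Gamma1 4 := by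
  have hS : S ^ 2 = -1 := by decide
  have hodd : ¬ 2 ∣ δ 1 1 := fun h => by
    have h := (isCoprime_lower_row δ).isUnit_of_dvd' (dvd_trans (by norm_num) hδ) h
    norm_num [Int.isUnit_iff] at h
  have hcases : δ 1 1 % 4 = 1 ∨ -δ 1 1 % 4 = 1 := by omega
  rw [hS, mul_neg_one, mem_Gamma1_four, mem_Gamma1_four]
  simpa [hδ] using hcases

theorem mul_inv_lower_left (α ρ : SL(2, ℤ)) :
    (α * ρ⁻¹) 1 0 = α 1 0 * ρ 1 1 - α 1 1 * ρ 1 0 := by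
  rw [Matrix.SpecialLinearGroup.coe_mul, Matrix.SpecialLinearGroup.SL2_inv_expl, Matrix.mul_apply,
    Fin.sum_univ_two]
  simp [sub_eq_add_neg]

/-- The three cases correspond to the cusps `i∞`, `0` and `-1/2` of `Γ₀(4)`. -/
theorem exists_eq_mul_of_four_dvd_lower_left (α : SL(2, ℤ)) : ∃ δ ρ : SL(2, ℤ),
    α = δ * ρ ∧ 4 ∣ δ 1 0 ∧ (ρ = 1 ∨ (∃ j : ℤ, ρ = S * T ^ j) ∨ ρ = S * T ^ (2 : ℤ) * S) := by
  suffices ∃ ρ : SL(2, ℤ), 4 ∣ (α * ρ⁻¹) 1 0 ∧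
      (ρ = 1 ∨ (∃ j : ℤ, ρ = S * T ^ j) ∨ ρ = S * T ^ (2 : ℤ) * S) by
    obtain ⟨ρ, h⟩ := this
    exact ⟨α * ρ⁻¹, ρ, (inv_mul_cancel_right α ρ).symm, h⟩
  have hcoprime : ¬ (2 ∣ α 1 0 ∧ 2 ∣ α 1 1) := fun ⟨hc, hd⟩ => by
    have h := (isCoprime_lower_row α).isUnit_of_dvd' hc hd
    norm_num [Int.isUnit_iff] at h
  rcases Int.even_or_odd' (α 1 0) with ⟨c, hc | hc⟩
  · by_cases h4 : 4 ∣ α 1 0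
    · exact ⟨1, by simpa using h4, .inl rfl⟩
    · refine ⟨S * T ^ (2 : ℤ) * S, ?_, .inr (.inr rfl)⟩
      have hρ : ((S * T ^ (2 : ℤ) * S : SL(2, ℤ)) : Matrix (Fin 2) (Fin 2) ℤ) =
          !![-1, 0; 2, -1] := by decide
      rw [mul_inv_lower_left, hρ]
      simp only [Matrix.of_apply, Matrix.cons_val_one, Matrix.cons_val_zero,
        Matrix.cons_val_fin_one]
      omega
  · refine ⟨S * T ^ (α 1 0 * α 1 1), ?_, .inr (.inl ⟨_, rfl⟩)⟩
    have hρ (j : ℤ) : ((S * T ^ j : SL(2, ℤ)) : Matrix (Fin 2) (Fin 2) ℤ) = !![0, -1; 1, j] := by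
      simp [coe_S, coe_T_zpow]
    rw [mul_inv_lower_left, hρ, hc]
    exact ⟨(c * c + c) * α 1 1, by simp; ring⟩

theorem lowerFour_mem_Gamma_four : lowerFour ∈ Gamma 4 := by
  rw [Gamma_mem, coe_lowerFour]
  exact ⟨rfl, rfl, rfl, rfl⟩

theorem halfSlash_thetaOdd_proportional {δ : SL(2, ℤ)} (hδ : 4 ∣ δ 1 0) :
    Proportional (halfSlash 1 thetaOdd δ) thetaOdd := by
  have hΓ : Gamma1 4 ≤ slashStabilizer 1 thetaOdd := by
    rw [← closure_T_lowerFour, Subgroup.closure_le]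
    rintro _ (rfl | rfl)
    · have hT := halfSlash_thetaOdd_T_zpow 1
      rw [zpow_one, zpow_one] at hT
      exact ⟨Complex.I, Complex.I_ne_zero, hT⟩
    · exact ⟨1, one_ne_zero, by
        rw [one_smul, thetaOdd_mem_modForms.2.1 _ lowerFour_mem_Gamma_four]⟩
  suffices h : δ ∈ slashStabilizer 1 thetaOdd from h
  have hS := mem_slashStabilizer.mpr (halfSlash_S_sq 1 thetaOdd)
  rcases mem_Gamma1_four_or_mul_S_sq_mem hδ with h | h
  · exact hΓ h
  · exact (Subgroup.mul_mem_cancel_right _ hS).mp (hΓ h)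

theorem isZeroAtImInfty_halfSlash_of_mem_Gamma1_four {k : ℕ} {f : ℍ → ℂ}
    (hf : f ∈ modForms (Gamma 4) k) (hf₀ : IsZeroAtImInfty f) {δ : SL(2, ℤ)}
    (hδ : δ ∈ Gamma1 4) : IsZeroAtImInfty (halfSlash k f δ) := by
  have hT (δ : SL(2, ℤ)) (h : IsZeroAtImInfty (halfSlash k f δ)) (n : ℤ) :
      IsZeroAtImInfty (halfSlash k f (δ * T ^ n)) := by
    refine (halfSlash_mul_right k f δ _).isZeroAtImInfty ?_
    rw [halfSlash_T_zpow]
    exact h.comp (tendsto_T_zpow_smul_atImInfty n)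
  have hΓ (δ γ : SL(2, ℤ)) (h : IsZeroAtImInfty (halfSlash k f δ)) (hγ : γ ∈ Gamma 4) :
      IsZeroAtImInfty (halfSlash k f (δ * γ)) := by
    refine (halfSlash_mul_right k f δ _).isZeroAtImInfty ?_
    rwa [(halfSlash_mem_modForms hf δ).2.1 γ hγ]
  have hU := lowerFour_mem_Gamma_four
  rw [← closure_T_lowerFour] at hδ
  induction hδ using Subgroup.closure_induction_right with
  | one => rwa [halfSlash_one_right]
  | mul_right δ _ γ hγ h =>
    rcases hγ with rfl | rfl
    · exact zpow_one T ▸ hT δ h 1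
    · exact hΓ δ _ h hU
  | mul_inv_cancel δ _ γ hγ h =>
    rcases hγ with rfl | rfl
    · exact zpow_neg_one T ▸ hT δ h (-1)
    · exact hΓ δ _ h (inv_mem hU)

theorem isZeroAtImInfty_halfSlash {k : ℕ} {f : ℍ → ℂ}
    (hf : f ∈ modForms (Gamma 4) k) (hf₀ : IsZeroAtImInfty f) {δ : SL(2, ℤ)}
    (hδ : 4 ∣ δ 1 0) : IsZeroAtImInfty (halfSlash k f δ) := by
  rcases mem_Gamma1_four_or_mul_S_sq_mem hδ with h | h
  · exact isZeroAtImInfty_halfSlash_of_mem_Gamma1_four hf hf₀ h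
  · exact ((halfSlash_mul_right k f δ _).trans
      (halfSlash_S_sq k _)).symm.isZeroAtImInfty
        (isZeroAtImInfty_halfSlash_of_mem_Gamma1_four hf hf₀ h)

theorem isBigO_of_tendsto_ne_zero {f g : ℍ → ℂ} {c : ℂ} (hf : IsBoundedAtImInfty f) (hc : c ≠ 0)
    (hg : Tendsto g atImInfty (𝓝 c)) : f =O[atImInfty] g :=
  hf.trans <| (isBigO_const_const (1 : ℝ) hc _).trans
    ((isEquivalent_const_iff_tendsto hc).mpr hg).isBigO_symm

theorem one_sub_I_ne_zero : 1 - Complex.I ≠ 0 := fun h => by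
  simpa using congrArg Complex.re h

theorem halfSlash_thetaOdd_S_mul_T_zpow (j : ℤ) :
    Proportional (halfSlash 1 thetaOdd (S * T ^ j)) (thetaEven - Complex.I ^ j • thetaOdd) := by
  refine (halfSlash_mul_right 1 thetaOdd S (T ^ j)).trans ?_
  refine ⟨(1 - Complex.I) / 2, div_ne_zero one_sub_I_ne_zero two_ne_zero, ?_⟩
  rw [halfSlash_thetaOdd_S, halfSlash_smul, sub_eq_add_neg thetaEven, ← neg_one_smul ℂ thetaOdd,
    halfSlash_add, halfSlash_smul, halfSlash_thetaEven_T_zpow, halfSlash_thetaOdd_T_zpow,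
    neg_one_smul, ← sub_eq_add_neg]

theorem halfSlash_thetaOdd_S_mul_T_zpow_two_mul_S :
    Proportional (halfSlash 1 thetaOdd (S * T ^ (2 : ℤ) * S)) thetaEven := by
  refine ((halfSlash_mul_right 1 thetaOdd _ S).trans
    ((halfSlash_thetaOdd_S_mul_T_zpow 2).halfSlash 1 S)).trans
    ⟨1 - Complex.I, one_sub_I_ne_zero, ?_⟩
  have hI : Complex.I ^ (2 : ℤ) = -1 := Complex.I_sq
  rw [hI, neg_one_smul, sub_neg_eq_add, halfSlash_add, halfSlash_thetaEven_S,
    halfSlash_thetaOdd_S, ← smul_add, add_add_sub_cancel, ← two_smul ℂ, smul_smul,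
    div_mul_cancel₀ _ two_ne_zero]

theorem isBigO_halfSlash_thetaOdd {k : ℕ} {f : ℍ → ℂ} (hf : f ∈ modForms (Gamma 4) k)
    (hf₀ : IsZeroAtImInfty f) (α : SL(2, ℤ)) :
    halfSlash k f α =O[atImInfty] halfSlash 1 thetaOdd α := by
  obtain ⟨δ, ρ, rfl, hδ, hρ⟩ := exists_eq_mul_of_four_dvd_lower_left α
  have hO : Proportional (halfSlash 1 thetaOdd ρ) (halfSlash 1 thetaOdd (δ * ρ)) :=
    ((halfSlash_mul_right 1 thetaOdd δ ρ).trans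
      ((halfSlash_thetaOdd_proportional hδ).halfSlash 1 ρ)).symm
  refine IsBigO.trans ?_ (hO.isBigO atImInfty)
  rcases hρ with rfl | ⟨j, rfl⟩ | rfl
  · rw [mul_one, halfSlash_one_right]
    exact (isBigO_cuspDecay (halfSlash_mem_modForms hf δ)
      (isZeroAtImInfty_halfSlash hf hf₀ hδ)).trans cuspDecay_isBigO_thetaOdd
  · have hlim : Tendsto (thetaEven - Complex.I ^ j • thetaOdd) atImInfty (𝓝 1) := by
      simpa [sub_eq_add_neg] using tendsto_linear_combination_theta 1 (-Complex.I ^ j)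
    exact (isBigO_of_tendsto_ne_zero (hf.2.2 _) one_ne_zero hlim).trans
      ((halfSlash_thetaOdd_S_mul_T_zpow j).symm.isBigO atImInfty)
  · exact (isBigO_of_tendsto_ne_zero (hf.2.2 _) one_ne_zero tendsto_thetaEven).trans
      (halfSlash_thetaOdd_S_mul_T_zpow_two_mul_S.symm.isBigO atImInfty)

theorem div_thetaOdd_mem_modForms {k : ℕ} {f : ℍ → ℂ} (hf : f ∈ modForms (Gamma 4) (k + 1))
    (hf₀ : IsZeroAtImInfty f) : f / thetaOdd ∈ modForms (Gamma 4) k :=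
  div_mem_modForms hf thetaOdd_mem_modForms thetaOdd_apply_ne_zero
    (isBigO_halfSlash_thetaOdd hf hf₀)

/-! ### Generators of the ring of modular forms -/

section Homogeneous

variable {Γ : Subgroup SL(2, ℤ)} {M N R : Submodule ℂ (ModRing Γ)} {j k : ℕ} {f g : ℍ → ℂ}

/-- The modular forms of weight `k/2` that, placed in degree `k`, lie in the subspace `M` of the
graded ring. Being a space of functions, it lets membership in subalgebras and ideals be checked
without transporting forms along equalities of weights. -/
noncomputable def homogeneousPart (M : Submodule ℂ (ModRing Γ)) (k : ℕ) : Submodule ℂ (ℍ → ℂ) :=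
  (M.comap (DirectSum.lof ℂ ℕ (fun k : ℕ => modForms Γ k) k)).map (modForms Γ k).subtype

theorem mem_homogeneousPart :
    f ∈ homogeneousPart M k ↔ ∃ hf : f ∈ modForms Γ k, ModRing.form hf ∈ M := by
  simp [homogeneousPart, ModRing.form, DirectSum.lof_eq_of]

theorem mul_mem_homogeneousPart (h : ∀ x ∈ M, ∀ y ∈ N, x * y ∈ R)
    (hf : f ∈ homogeneousPart M j) (hg : g ∈ homogeneousPart N k) :
    f * g ∈ homogeneousPart R (j + k) := by
  rw [mem_homogeneousPart] at hf hg ⊢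
  obtain ⟨hf, hfM⟩ := hf
  obtain ⟨hg, hgN⟩ := hg
  refine ⟨SetLike.mul_mem_graded hf hg, ?_⟩
  have hmul : ModRing.form hf * ModRing.form hg = ModRing.form (SetLike.mul_mem_graded hf hg) :=
    DirectSum.of_mul_of _ _
  exact hmul ▸ h _ hfM _ hgN

theorem one_mem_homogeneousPart (A : Subalgebra ℂ (ModRing Γ)) :
    1 ∈ homogeneousPart A.toSubmodule 0 :=
  mem_homogeneousPart.mpr ⟨SetLike.one_mem_graded _, A.one_mem⟩

theorem pow_mem_homogeneousPart {A : Subalgebra ℂ (ModRing Γ)}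
    (hf : f ∈ homogeneousPart A.toSubmodule 1) (n : ℕ) :
    f ^ n ∈ homogeneousPart A.toSubmodule n := by
  induction n with
  | zero => exact pow_zero f ▸ one_mem_homogeneousPart A
  | succ n ih =>
    exact pow_succ f n ▸ mul_mem_homogeneousPart (fun _ hx _ hy => A.mul_mem hx hy) ih hf

theorem mem_of_forall_mem_homogeneousPart {F : ModRing Γ}
    (hF : ∀ k, (F k : ℍ → ℂ) ∈ homogeneousPart M k) : F ∈ M := by
  classical
  rw [← DirectSum.sum_support_of F]
  refine M.sum_mem fun k _ => ?_
  obtain ⟨_, h⟩ := mem_homogeneousPart.mp (hF k)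
  exact h

end Homogeneous

open scoped ModularForm in
theorem exists_eq_const_of_mem_modForms_zero {f : ℍ → ℂ} (hf : f ∈ modForms (Gamma 4) 0) :
    ∃ c : ℂ, f = c • 1 := by
  have hslash (α : SL(2, ℤ)) : f ∣[(0 : ℤ)] α = halfSlash 0 f α := by
    ext τ
    simp [ModularForm.SL_slash_apply, halfSlash]
  let F : ModularForm ((Gamma 4).map (Matrix.SpecialLinearGroup.mapGL ℝ)) 0 :=
    { toFun := f
      slash_action_eq' := by
        rintro _ ⟨γ, hγ, rfl⟩
        exact (hslash γ).trans (hf.2.1 γ hγ)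
      holo' := hf.1
      bdd_at_cusps' := by
        intro c hc
        rw [Subgroup.IsArithmetic.isCusp_iff_isCusp_SL2Z] at hc
        rw [OnePoint.isBoundedAt_iff_forall_SL2Z hc]
        intro α _
        rw [hslash]
        exact hf.2.2 α }
  obtain ⟨c, hc⟩ := ModularForm.eq_const_of_weight_zero F
  exact ⟨c, funext fun τ => (congrFun hc τ).trans (mul_one c).symm⟩

/-- A form with limit `c` at `i∞` differs from `c * θ ^ k` by a form divisible by
`θ(τ/4) - θ(τ)`. -/
theorem modForms_le_homogeneousPart {A : Subalgebra ℂ (ModRing (Gamma 4))}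
    (hE : thetaEven ∈ homogeneousPart A.toSubmodule 1)
    (hO : thetaOdd ∈ homogeneousPart A.toSubmodule 1) (k : ℕ) :
    modForms (Gamma 4) k ≤ homogeneousPart A.toSubmodule k := by
  induction k with
  | zero =>
    intro f hf
    obtain ⟨c, rfl⟩ := exists_eq_const_of_mem_modForms_zero hf
    exact Submodule.smul_mem _ c (one_mem_homogeneousPart A)
  | succ k ih =>
    intro f hf
    obtain ⟨c, hc⟩ := exists_tendsto_atImInfty hf
    have hEpow := pow_mem_homogeneousPart hE (k + 1)
    have hsub : f - c • thetaEven ^ (k + 1) ∈ modForms (Gamma 4) (k + 1) :=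
      sub_mem hf (Submodule.smul_mem _ c (mem_homogeneousPart.mp hEpow).1)
    have hzero : IsZeroAtImInfty (f - c • thetaEven ^ (k + 1)) := by
      have h := hc.sub ((tendsto_thetaEven.pow (k + 1)).const_mul c)
      rwa [one_pow, mul_one, sub_self] at h
    have hdecomp : f = (f - c • thetaEven ^ (k + 1)) / thetaOdd * thetaOdd +
        c • thetaEven ^ (k + 1) := by
      ext τ
      simp [div_mul_cancel₀ _ (thetaOdd_apply_ne_zero τ)]
    rw [hdecomp]
    exact add_mem (mul_mem_homogeneousPart (fun _ hx _ hy => A.mul_mem hx hy)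
      (ih (div_thetaOdd_mem_modForms hsub hzero)) hO) (Submodule.smul_mem _ c hEpow)

theorem adjoin_pair_eq_top {f g : ℍ → ℂ} (hf : f ∈ modForms (Gamma 4) 1)
    (hg : g ∈ modForms (Gamma 4) 1) (h : thetaSpace ≤ Submodule.span ℂ {f, g}) :
    Algebra.adjoin ℂ {ModRing.form hf, ModRing.form hg} = ⊤ := by
  set A := Algebra.adjoin ℂ {ModRing.form hf, ModRing.form hg}
  have hspan : Submodule.span ℂ {f, g} ≤ homogeneousPart A.toSubmodule 1 :=
    Submodule.span_le.mpr <| Set.pair_subset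
      (mem_homogeneousPart.mpr ⟨hf, Algebra.subset_adjoin (Set.mem_insert _ _)⟩)
      (mem_homogeneousPart.mpr ⟨hg, Algebra.subset_adjoin (Set.mem_insert_of_mem _ rfl)⟩)
  have hA := modForms_le_homogeneousPart (hspan (h thetaEven_mem_thetaSpace))
    (hspan (h thetaOdd_mem_thetaSpace))
  exact eq_top_iff.mpr fun F _ => mem_of_forall_mem_homogeneousPart (M := A.toSubmodule)
    fun k => hA k (F k).2

/-! ### Algebraic independence -/

theorem mvPolynomial_eq_zero_of_eval_mul_eq_zero {K : Type*} [Field K] {R : Set K}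
    (hR : R.Infinite) {F : MvPolynomial (Fin 2) K}
    (hF : ∀ r ∈ R, ∀ x, MvPolynomial.eval ![x * r, x] F = 0) : F = 0 := by
  have : Infinite K := Set.infinite_univ_iff.mp (hR.mono (Set.subset_univ R))
  refine MvPolynomial.funext_set ![Set.univ, {0}ᶜ] ?_ fun x hx => ?_
  · rw [Fin.forall_fin_two]
    exact ⟨Set.infinite_univ, (Set.finite_singleton 0).infinite_compl⟩
  let P : Polynomial K := MvPolynomial.aeval ![Polynomial.X, Polynomial.C (x 1)] F
  have hP (y : K) : P.eval y = MvPolynomial.eval ![y, x 1] F := by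
    rw [← Polynomial.coe_evalRingHom, MvPolynomial.map_aeval, MvPolynomial.eval]
    refine MvPolynomial.eval₂Hom_congr (by ext; simp) (funext fun i => ?_) rfl
    fin_cases i <;> simp
  have hroots : {y | P.IsRoot y}.Infinite := by
    refine (hR.image (mul_right_injective₀ (hx 1 trivial)).injOn).mono ?_
    rintro _ ⟨r, hr, rfl⟩
    exact (hP _).trans (hF r hr (x 1))
  rw [map_zero, ← Polynomial.eval_zero (x := x 0), ← Polynomial.eq_zero_of_infinite_isRoot P hroots,
    hP]
  congr 2
  ext i
  fin_cases i <;> rfl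

/-- The evaluation `∑ f_k ↦ ∑ μ ^ k * f_k(τ)` of the graded ring at a point `τ`; the parameter `μ`
keeps track of the grading. -/
noncomputable def evalHom (Γ : Subgroup SL(2, ℤ)) (τ : ℍ) (μ : ℂ) : ModRing Γ →ₐ[ℂ] ℂ :=
  DirectSum.toAlgebra ℂ (fun k : ℕ => modForms Γ k)
    (fun k => μ ^ k • (LinearMap.proj τ).comp (modForms Γ k).subtype)
    ((congrArg (· • (1 : ℂ)) (pow_zero μ)).trans (one_smul ℂ 1))
    (fun {i j} f g => by
      change μ ^ (i + j) • ((f : ℍ → ℂ) τ * (g : ℍ → ℂ) τ) =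
        (μ ^ i • (f : ℍ → ℂ) τ) * (μ ^ j • (g : ℍ → ℂ) τ)
      rw [pow_add, smul_mul_smul_comm])

theorem evalHom_form {Γ : Subgroup SL(2, ℤ)} {k : ℕ} {f : ℍ → ℂ} (hf : f ∈ modForms Γ k) (τ : ℍ)
    (μ : ℂ) : evalHom Γ τ μ (ModRing.form hf) = μ ^ k * f τ :=
  DirectSum.toAddMonoid_of (β := fun k : ℕ => modForms Γ k)
    (fun k => (μ ^ k • (LinearMap.proj τ).comp (modForms Γ k).subtype).toAddMonoidHom) k ⟨f, hf⟩

theorem infinite_range_of_linearIndependent {X : Type*} [TopologicalSpace X] [PreconnectedSpace X]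
    {f g : X → ℂ} (hf : Continuous f) (hg : Continuous g) (hg₀ : ∀ x, g x ≠ 0)
    (hfg : LinearIndependent ℂ ![f, g]) : (Set.range fun x => f x / g x).Infinite := by
  refine (isPreconnected_range (hf.div hg hg₀)).infinite_of_nontrivial ?_
  by_contra hconst
  rw [Set.not_nontrivial_iff] at hconst
  obtain ⟨c, hc⟩ : ∃ c, ∀ x, f x / g x = c := by
    rcases isEmpty_or_nonempty X with _ | ⟨⟨x₀⟩⟩
    · exact ⟨0, isEmptyElim⟩
    · exact ⟨_, fun x => hconst ⟨x, rfl⟩ ⟨x₀, rfl⟩⟩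
  have hfg₀ : (1 : ℂ) • f + (-c) • g = 0 := by
    ext x
    simp [← hc x, div_mul_cancel₀ _ (hg₀ x)]
  exact one_ne_zero (LinearIndependent.pair_iff.mp hfg _ _ hfg₀).1

theorem algebraicIndependent_pair {Γ : Subgroup SL(2, ℤ)} {k : ℕ} (hk : k ≠ 0) {f g : ℍ → ℂ}
    (hf : f ∈ modForms Γ k) (hg : g ∈ modForms Γ k) (hg₀ : ∀ τ, g τ ≠ 0)
    (hfg : LinearIndependent ℂ ![f, g]) :
    AlgebraicIndependent ℂ ![ModRing.form hf, ModRing.form hg] := by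
  rw [algebraicIndependent_iff]
  intro F hF
  refine mvPolynomial_eq_zero_of_eval_mul_eq_zero
    (infinite_range_of_linearIndependent hf.1.continuous hg.1.continuous hg₀ hfg) ?_
  rintro _ ⟨τ, rfl⟩ x
  obtain ⟨μ, hμ⟩ := IsAlgClosed.exists_pow_nat_eq (x / g τ) (Nat.pos_of_ne_zero hk)
  have h := congrArg (evalHom Γ τ μ) hF
  rw [map_zero, MvPolynomial.comp_aeval_apply] at h
  rw [← h, ← MvPolynomial.coe_aeval_eq_eval, RingHom.coe_coe]
  congr 2
  ext i
  have hgτ := hg₀ τ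
  fin_cases i
  · simp [evalHom_form, hμ, div_mul_eq_mul_div, mul_div_assoc]
  · simp [evalHom_form, hμ, div_mul_cancel₀ _ hgτ]

theorem linearIndependent_thetaEven_thetaOdd : LinearIndependent ℂ ![thetaEven, thetaOdd] := by
  rw [LinearIndependent.pair_iff]
  intro a b h
  obtain rfl : a = 0 := tendsto_nhds_unique (tendsto_linear_combination_theta a b)
    (h ▸ tendsto_const_nhds)
  rw [zero_smul, zero_add] at h
  exact ⟨rfl, (smul_eq_zero.mp h).resolve_right thetaOdd_ne_zero⟩

theorem linearIndependent_pair_of_thetaSpace_le {f g : ℍ → ℂ}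
    (h : thetaSpace ≤ Submodule.span ℂ {f, g}) : LinearIndependent ℂ ![f, g] := by
  have hrange (f g : ℍ → ℂ) : Set.range ![f, g] = {f, g} := Matrix.range_cons_cons_empty f g ![]
  have : FiniteDimensional ℂ (Submodule.span ℂ (Set.range ![f, g])) :=
    FiniteDimensional.span_of_finite ℂ (Set.finite_range _)
  rw [thetaSpace, ← hrange, ← hrange] at h
  rw [linearIndependent_iff_card_le_finrank_span,
    linearIndependent_iff_card_eq_finrank_span.mp linearIndependent_thetaEven_thetaOdd]
  exact Submodule.finrank_mono h

theorem algebraicIndependent_and_adjoin_eq_top {f g : ℍ → ℂ} (hf : f ∈ modForms (Gamma 4) 1)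
    (hg : g ∈ modForms (Gamma 4) 1) (hg₀ : ∀ τ, g τ ≠ 0)
    (h : thetaSpace ≤ Submodule.span ℂ {f, g}) :
    AlgebraicIndependent ℂ ![ModRing.form hf, ModRing.form hg] ∧
      Algebra.adjoin ℂ {ModRing.form hf, ModRing.form hg} = ⊤ :=
  ⟨algebraicIndependent_pair one_ne_zero hf hg hg₀ (linearIndependent_pair_of_thetaSpace_le h),
    adjoin_pair_eq_top hf hg h⟩

/-! ### The ideal of cusp forms -/

theorem halfSlash_etaSix (α : SL(2, ℤ)) : Proportional (halfSlash 6 etaSix α) etaSix :=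
  mem_slashStabilizer.mp (slashStabilizer_etaSix ▸ Subgroup.mem_top α)

theorem isZeroAtImInfty_etaSix : IsZeroAtImInfty etaSix :=
  thetaProd_proportional_etaSix.symm.isZeroAtImInfty isZeroAtImInfty_thetaProd

theorem etaSix_mem_cuspForms : etaSix ∈ cuspForms (Gamma 4) 6 :=
  ⟨etaSix_mem_modForms.1, etaSix_mem_modForms.2.1, fun α =>
    (halfSlash_etaSix α).isZeroAtImInfty isZeroAtImInfty_etaSix⟩

theorem cuspForms_le_modForms (Γ : Subgroup SL(2, ℤ)) (k : ℕ) : cuspForms Γ k ≤ modForms Γ k :=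
  fun _ hf => ⟨hf.1, hf.2.1, fun α => (hf.2.2 α).isBoundedAtImInfty⟩

theorem div_etaSix_mem_modForms {k : ℕ} {f : ℍ → ℂ} (hf : f ∈ cuspForms (Gamma 4) (k + 6)) :
    f / etaSix ∈ modForms (Gamma 4) k :=
  div_mem_modForms (cuspForms_le_modForms _ _ hf) etaSix_mem_modForms etaSix_ne_zero fun α =>
    ((isBigO_cuspDecay (halfSlash_mem_modForms (cuspForms_le_modForms _ _ hf) α) (hf.2.2 α)).trans
      cuspDecay_isBigO_etaSix).trans ((halfSlash_etaSix α).symm.isBigO atImInfty)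

theorem exists_eq_smul_etaSix {f : ℍ → ℂ} (hf : f ∈ cuspForms (Gamma 4) 6) :
    ∃ c : ℂ, f = c • etaSix := by
  obtain ⟨c, hc⟩ := exists_eq_const_of_mem_modForms_zero (div_etaSix_mem_modForms (k := 0) hf)
  refine ⟨c, funext fun τ => ?_⟩
  rw [← div_mul_cancel₀ (f τ) (etaSix_ne_zero τ), ← Pi.div_apply, hc]
  simp

/-- Multiplied by `θ(τ) ^ n` or by `(θ(τ/4) - θ(τ)) ^ n`, with `n = 6 - k`, the form `f` becomes a
multiple of `η ^ 6`; the two multiples are incompatible at `i∞` unless both vanish. -/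
theorem eq_zero_of_mem_cuspForms {k : ℕ} (hk : k < 6) {f : ℍ → ℂ}
    (hf : f ∈ cuspForms (Gamma 4) k) : f = 0 := by
  obtain ⟨n, hn⟩ := Nat.exists_eq_add_of_lt hk
  have hmul {g : ℍ → ℂ} (hg : g ∈ modForms (Gamma 4) 1) :
      ∃ c : ℂ, g ^ (n + 1) * f = c • etaSix := by
    have hpow : g ^ (n + 1) ∈ modForms (Gamma 4) ((n + 1) • 1) :=
      SetLike.pow_mem_graded (n + 1) hg
    refine exists_eq_smul_etaSix ?_
    rw [hn, show k + n + 1 = (n + 1) • 1 + k by rw [smul_eq_mul]; omega]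
    exact mul_mem_cuspForms hpow hf
  obtain ⟨c, hc⟩ := hmul thetaEven_mem_modForms
  obtain ⟨d, hd⟩ := hmul thetaOdd_mem_modForms
  have hcd : d • thetaEven ^ (n + 1) = c • thetaOdd ^ (n + 1) := by
    ext τ
    have hcτ := congrFun hc τ
    have hdτ := congrFun hd τ
    simp only [Pi.mul_apply, Pi.pow_apply, Pi.smul_apply, smul_eq_mul] at hcτ hdτ ⊢
    refine mul_right_cancel₀ (etaSix_ne_zero τ) ?_
    linear_combination thetaOdd τ ^ (n + 1) * hcτ - thetaEven τ ^ (n + 1) * hdτ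
  obtain rfl : d = 0 := by
    have hE := (tendsto_thetaEven.pow (n + 1)).const_mul d
    have hO := (tendsto_thetaOdd.pow (n + 1)).const_mul c
    rw [one_pow, mul_one] at hE
    rw [zero_pow n.succ_ne_zero, mul_zero] at hO
    exact tendsto_nhds_unique hE (hO.congr fun τ => (congrFun hcd τ).symm)
  ext τ
  have hdτ := congrFun hd τ
  rw [zero_smul] at hdτ
  exact (mul_eq_zero.mp hdτ).resolve_left (pow_ne_zero _ (thetaOdd_apply_ne_zero τ))

theorem cuspIdeal_eq_span :
    cuspIdeal (Gamma 4) = Ideal.span {ModRing.form etaSix_mem_modForms} := by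
  have : IsScalarTower ℂ (ModRing (Gamma 4)) (ModRing (Gamma 4)) :=
    ⟨Algebra.smul_mul_assoc⟩
  set J := Ideal.span {ModRing.form etaSix_mem_modForms} with hJ
  have hη : etaSix ∈ homogeneousPart (J.restrictScalars ℂ) 6 :=
    mem_homogeneousPart.mpr ⟨etaSix_mem_modForms, Ideal.mem_span_singleton_self _⟩
  apply le_antisymm
  · refine fun F hF => mem_of_forall_mem_homogeneousPart (M := J.restrictScalars ℂ) fun k => ?_
    rcases lt_or_ge k 6 with hk | hk
    · rw [eq_zero_of_mem_cuspForms hk (hF k)]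
      exact Submodule.zero_mem _
    · obtain ⟨n, rfl⟩ := Nat.exists_eq_add_of_le' hk
      have hdiv : (F (n + 6) : ℍ → ℂ) = (F (n + 6) : ℍ → ℂ) / etaSix * etaSix := by
        ext τ
        exact (div_mul_cancel₀ _ (etaSix_ne_zero τ)).symm
      rw [hdiv]
      exact mul_mem_homogeneousPart (M := ⊤) (fun x _ _ hy => J.mul_mem_left x hy)
        (mem_homogeneousPart.mpr ⟨div_etaSix_mem_modForms (hF _), trivial⟩) hη
  · rw [hJ, Ideal.span_singleton_le_iff_mem]
    intro k
    rcases eq_or_ne k 6 with rfl | hk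
    · rw [ModRing.form, DirectSum.of_eq_same]
      exact etaSix_mem_cuspForms
    · rw [ModRing.form, DirectSum.of_eq_of_ne _ _ _ hk]
      exact Submodule.zero_mem _

/-! ### Eta quotients -/

theorem sqrt_ofReal_mul {r : ℝ} (hr : 0 < r) {z : ℂ} (hz : z ∈ Complex.slitPlane) :
    (r * z) ^ (1 / 2 : ℂ) = √r * z ^ (1 / 2 : ℂ) := by
  refine (eq_sqrt_of_sq_eq ?_ ?_).symm
  · rw [mul_pow, sqrt_sq, ← Complex.ofReal_pow, Real.sq_sqrt hr.le]
  · rw [Complex.re_ofReal_mul]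
    exact mul_pos (Real.sqrt_pos.mpr hr) (sqrt_re_pos hz)

theorem hasSum_prod_mul {α β : Type*} {f : α → ℂ} {g : β → ℂ} {a b : ℂ} (hf : HasSum f a)
    (hg : HasSum g b) : HasSum (fun p : α × β => f p.1 * g p.2) (a * b) :=
  hf.mul hg (summable_mul_of_summable_norm hf.summable.norm hg.summable.norm)

/-- Every pair of integers is `(m + n, m - n)` or `(m + n + 1, m - n)`, according to parity. -/
theorem hasSum_int_prod_of_parity {f : ℤ × ℤ → ℂ} {a b : ℂ}
    (ha : HasSum (fun p : ℤ × ℤ => f (p.1 + p.2, p.1 - p.2)) a)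
    (hb : HasSum (fun p : ℤ × ℤ => f (p.1 + p.2 + 1, p.1 - p.2)) b) : HasSum f (a + b) := by
  refine hasSum_add_of_isCompl_range (φ := fun p : ℤ × ℤ => (p.1 + p.2, p.1 - p.2))
    (ψ := fun p : ℤ × ℤ => (p.1 + p.2 + 1, p.1 - p.2)) ?_ ?_ ?_ ha hb
  · rintro ⟨m, n⟩ ⟨m', n'⟩ h
    simp only [Prod.mk.injEq] at h ⊢
    omega
  · rintro ⟨m, n⟩ ⟨m', n'⟩ h
    simp only [Prod.mk.injEq] at h ⊢
    omega
  · refine ⟨Set.disjoint_left.mpr ?_, codisjoint_iff_le_sup.mpr ?_⟩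
    · rintro _ ⟨p, rfl⟩ ⟨p', h⟩
      simp only [Prod.mk.injEq] at h
      omega
    · rintro ⟨m, n⟩ -
      rcases Int.even_or_odd' (m + n) with ⟨k, hk | hk⟩
      · exact .inl ⟨(k, m - k), Prod.ext_iff.mpr ⟨by dsimp only; omega, by dsimp only; omega⟩⟩
      · exact .inr ⟨(k, m - 1 - k), Prod.ext_iff.mpr ⟨by dsimp only; omega, by dsimp only; omega⟩⟩

/-- The point `2τ` of the upper half-plane. -/
noncomputable def double (τ : ℍ) : ℍ := (⟨2, two_pos⟩ : {x : ℝ // 0 < x}) • τ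

theorem coe_double (τ : ℍ) : (double τ : ℂ) = 2 * τ := by
  simp [double]

theorem thetaEven_double_sq_add_thetaOdd_double_sq (τ : ℍ) :
    thetaEven (double τ) ^ 2 + thetaOdd (double τ) ^ 2 = thetaEven τ ^ 2 := by
  have hE := hasSum_thetaEven (double τ)
  have hO := hasSum_thetaOdd (double τ)
  rw [sq, sq, sq]
  refine HasSum.unique (hasSum_int_prod_of_parity ((hasSum_prod_mul hE hE).congr_fun fun p => ?_)
    ((hasSum_prod_mul hO hO).congr_fun fun p => ?_))
    (hasSum_prod_mul (hasSum_thetaEven τ) (hasSum_thetaEven τ))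
  all_goals
    rw [← Complex.exp_add, ← Complex.exp_add, coe_double]
    congr 1
    push_cast
    ring

theorem two_mul_thetaEven_double_mul_thetaOdd_double (τ : ℍ) :
    2 * (thetaEven (double τ) * thetaOdd (double τ)) = thetaOdd τ ^ 2 := by
  have hE := hasSum_thetaEven (double τ)
  have hO := hasSum_thetaOdd (double τ)
  have hE' := (Equiv.addRight (1 : ℤ)).hasSum_iff.mpr hE
  rw [sq, two_mul]
  nth_rw 1 [mul_comm]
  refine HasSum.unique (hasSum_int_prod_of_parity ((hasSum_prod_mul hO hE).congr_fun fun p => ?_)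
    ((hasSum_prod_mul hE' hO).congr_fun fun p => ?_))
    (hasSum_prod_mul (hasSum_thetaOdd τ) (hasSum_thetaOdd τ))
  all_goals
    simp only [Function.comp_apply, Equiv.coe_addRight]
    rw [← Complex.exp_add, ← Complex.exp_add, coe_double]
    congr 1
    push_cast
    ring

theorem thetaProd_double_sq (τ : ℍ) : 4 * thetaProd (double τ) ^ 2 =
    thetaEven τ ^ 4 * thetaOdd τ ^ 4 * (thetaEven τ ^ 4 - thetaOdd τ ^ 4) := by
  simp only [thetaProd, Pi.mul_apply, Pi.sub_apply, Pi.pow_apply]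
  rw [show thetaOdd τ ^ 4 = (thetaOdd τ ^ 2) ^ 2 by ring,
    show thetaEven τ ^ 4 = (thetaEven τ ^ 2) ^ 2 by ring,
    ← thetaEven_double_sq_add_thetaOdd_double_sq τ,
    ← two_mul_thetaEven_double_mul_thetaOdd_double τ]
  ring

theorem thetaProd_double_double_pow_four (τ : ℍ) :
    2 ^ 12 * thetaProd (double (double τ)) ^ 4 =
      thetaEven τ ^ 4 * thetaOdd τ ^ 16 * (thetaEven τ ^ 4 - thetaOdd τ ^ 4) := by
  have h := thetaProd_double_sq (double τ)
  rw [show thetaOdd τ ^ 16 = (thetaOdd τ ^ 2) ^ 8 by ring,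
    show thetaOdd τ ^ 4 = (thetaOdd τ ^ 2) ^ 2 by ring,
    show thetaEven τ ^ 4 = (thetaEven τ ^ 2) ^ 2 by ring,
    ← thetaEven_double_sq_add_thetaOdd_double_sq τ,
    ← two_mul_thetaEven_double_mul_thetaOdd_double τ]
  calc 2 ^ 12 * thetaProd (double (double τ)) ^ 4
      = 2 ^ 8 * (4 * thetaProd (double (double τ)) ^ 2) ^ 2 := by ring
    _ = _ := by rw [h]; ring

theorem continuous_eta_ofReal_mul {r : ℝ} (hr : 0 < r) :
    Continuous fun τ : ℍ => ModularForm.eta (r * τ) := by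
  refine continuous_iff_continuousAt.mpr fun τ => ?_
  have hη : ContinuousAt ModularForm.eta (r * τ) :=
    (ModularForm.differentiableAt_eta_of_mem_upperHalfPlaneSet
      (by simpa using mul_pos hr τ.im_pos)).continuousAt
  exact hη.comp (f := fun τ : ℍ => (r : ℂ) * τ) (by fun_prop)

theorem continuous_etaSharp_two_mul : Continuous fun τ : ℍ => etaSharp (2 * τ) := by
  refine Continuous.div (.pow ?_ 2) ?_ fun τ => ModularForm.eta_ne_zero (by simpa using τ.im_pos)
  · refine (continuous_eta_ofReal_mul four_pos).congr fun τ => ?_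
    push_cast
    ring_nf
  · exact_mod_cast continuous_eta_ofReal_mul two_pos

theorem etaSharp_two_mul_pow_twelve (τ : ℍ) : etaSharp (2 * τ) ^ 12 =
    etaSix (double (double τ)) ^ 4 / etaSix (double τ) ^ 2 := by
  rw [etaSharp, etaSix, etaSix, coe_double, coe_double, div_pow]
  ring

theorem etaSharp_two_mul_proportional_thetaOdd :
    Proportional (fun τ : ℍ => etaSharp (2 * τ)) thetaOdd := by
  refine .of_pow (n := 12) (by norm_num) continuous_etaSharp_two_mul
    mdifferentiable_thetaOdd.continuous thetaOdd_apply_ne_zero ?_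
  have hη : (fun τ : ℍ => etaSharp (2 * τ)) ^ 12 =
      (etaSix ∘ double ∘ double) ^ 4 / (etaSix ∘ double) ^ 2 :=
    funext etaSharp_two_mul_pow_twelve
  have hθ : (thetaProd ∘ double ∘ double) ^ 4 / (thetaProd ∘ double) ^ 2 =
      (1 / 2 ^ 10 : ℂ) • thetaOdd ^ 12 := by
    ext τ
    have h₂ := thetaProd_double_sq τ
    have h₄ := thetaProd_double_double_pow_four τ
    simp only [Pi.div_apply, Pi.pow_apply, Pi.smul_apply, Function.comp_apply, smul_eq_mul]
    rw [div_eq_iff (pow_ne_zero 2 (thetaProd_apply_ne_zero _))]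
    linear_combination h₄ / 2 ^ 12 - thetaOdd τ ^ 12 * h₂ / 2 ^ 12
  have hηθ := thetaProd_proportional_etaSix.symm
  rw [hη]
  exact (((hηθ.comp (double ∘ double)).pow 4).div ((hηθ.comp double).pow 2)).trans
    ⟨_, by norm_num, hθ⟩

theorem eta_neg_inv {z : ℂ} (hz : 0 < z.im) : ModularForm.eta (-1 / z) =
    (Complex.I ^ (1 / 2 : ℂ))⁻¹ * (z ^ (1 / 2 : ℂ) * ModularForm.eta z) := by
  simpa [Complex.sqrt] using ModularForm.eta_comp_eq_csqrt_I_inv (x := z) hz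

theorem etaSharp_two_mul_S_smul (τ : ℍ) : etaSharp (2 * (S • τ : ℍ)) =
    (Complex.I ^ (1 / 2 : ℂ))⁻¹ / 2 * ((τ : ℂ) / 2) ^ (1 / 2 : ℂ) * etaFlat ((τ : ℂ) / 2) := by
  have him : 0 < ((τ : ℂ) / 2).im := by simpa using τ.im_pos
  have him' : 0 < ((τ : ℂ) / 2 / 2).im := by simpa using τ.im_pos
  have hsq : ((τ : ℂ) / 2 / 2) = (((τ : ℂ) / 2) ^ (1 / 2 : ℂ)) ^ 2 / 2 := by rw [sqrt_sq]
  have hS : 2 * ((S • τ : ℍ) : ℂ) = -1 / ((τ : ℂ) / 2) := by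
    rw [modular_S_smul]
    field_simp
  have hS' : 2 * (2 * ((S • τ : ℍ) : ℂ)) = -1 / ((τ : ℂ) / 2 / 2) := by
    rw [hS]
    field_simp
  have hI := sqrt_ne_zero Complex.I_ne_zero
  have hτ : ((τ : ℂ) / 2) ^ (1 / 2 : ℂ) ≠ 0 := sqrt_ne_zero (div_ne_zero τ.ne_zero two_ne_zero)
  rw [etaSharp, etaFlat, hS', hS, eta_neg_inv him, eta_neg_inv him', mul_pow, mul_pow, sqrt_sq, hsq]
  field_simp

theorem halfSlash_etaSharp_S : Proportional
    (halfSlash 1 (fun τ : ℍ => etaSharp (2 * τ)) S) (fun τ : ℍ => etaFlat ((τ : ℂ) / 2)) := by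
  refine ⟨(Complex.I ^ (1 / 2 : ℂ))⁻¹ / 2 * √(1 / 2), ?_, funext fun τ => ?_⟩
  · simp
  · have hτ : ((τ : ℂ) / 2) ^ (1 / 2 : ℂ) = √(1 / 2) * (τ : ℂ) ^ (1 / 2 : ℂ) := by
      have h := sqrt_ofReal_mul one_half_pos (Or.inr τ.im_ne_zero : (τ : ℂ) ∈ Complex.slitPlane)
      rw [← h]
      push_cast
      ring_nf
    rw [halfSlash, halfFactor_S, etaSharp_two_mul_S_smul, hτ, pow_one, ← mul_assoc, mul_right_comm,
      mul_div_cancel_right₀ _ (sqrt_ne_zero τ.ne_zero)]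
    rfl

theorem etaFlat_div_two_proportional :
    Proportional (fun τ : ℍ => etaFlat ((τ : ℂ) / 2)) (thetaEven - thetaOdd) :=
  halfSlash_etaSharp_S.symm.trans <|
    (etaSharp_two_mul_proportional_thetaOdd.halfSlash 1 S).trans
      ⟨_, div_ne_zero one_sub_I_ne_zero two_ne_zero, halfSlash_thetaOdd_S⟩

theorem theta_div_four_eq : (fun τ : ℍ => theta ((τ : ℂ) / 4)) = thetaEven + thetaOdd := by
  ext τ
  simp [thetaEven, thetaOdd]

theorem theta_div_four_mem_modForms :
    (fun τ : ℍ => theta ((τ : ℂ) / 4)) ∈ modForms (Gamma 4) 1 :=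
  theta_div_four_eq ▸ add_mem thetaEven_mem_modForms thetaOdd_mem_modForms

theorem etaFlat_div_two_mem_modForms :
    (fun τ : ℍ => etaFlat ((τ : ℂ) / 2)) ∈ modForms (Gamma 4) 1 :=
  etaFlat_div_two_proportional.mem (sub_mem thetaEven_mem_modForms thetaOdd_mem_modForms)

theorem etaSharp_two_mul_mem_modForms :
    (fun τ : ℍ => etaSharp (2 * (τ : ℂ))) ∈ modForms (Gamma 4) 1 :=
  etaSharp_two_mul_proportional_thetaOdd.mem thetaOdd_mem_modForms

theorem etaSharp_two_mul_ne_zero (τ : ℍ) : etaSharp (2 * (τ : ℂ)) ≠ 0 :=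
  etaSharp_two_mul_proportional_thetaOdd.ne_zero (thetaOdd_apply_ne_zero τ)

theorem thetaSpace_le_span_theta :
    thetaSpace ≤ Submodule.span ℂ {(fun τ : ℍ => theta ((τ : ℂ) / 4)), thetaEven} := by
  rw [theta_div_four_eq, thetaSpace, Submodule.span_le, Set.pair_subset_iff]
  have hE := Submodule.mem_span_of_mem (R := ℂ)
    (Set.mem_insert_of_mem (thetaEven + thetaOdd) (Set.mem_singleton thetaEven))
  exact ⟨hE, (Submodule.add_mem_iff_right _ hE).mp
    (Submodule.mem_span_of_mem (Set.mem_insert _ _))⟩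

theorem thetaSpace_le_span_eta :
    thetaSpace ≤ Submodule.span ℂ
      {(fun τ : ℍ => etaFlat ((τ : ℂ) / 2)), (fun τ : ℍ => etaSharp (2 * (τ : ℂ)))} := by
  rw [thetaSpace, Submodule.span_le, Set.pair_subset_iff]
  have hO := etaSharp_two_mul_proportional_thetaOdd.symm.mem <| Submodule.mem_span_of_mem (R := ℂ)
    (Set.mem_insert_of_mem (fun τ : ℍ => etaFlat ((τ : ℂ) / 2)) (Set.mem_singleton _))
  have hEO := etaFlat_div_two_proportional.symm.mem <| Submodule.mem_span_of_mem (R := ℂ)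
    (Set.mem_insert _ {fun τ : ℍ => etaSharp (2 * (τ : ℂ))})
  exact ⟨(Submodule.sub_mem_iff_left _ hO).mp hEO, hO⟩

end HalfIntegralWeight

theorem mainTheorem3 :
    -- `θ(τ/4)`, `θ(τ)`, `η^♭(τ/2)` and `η^♯(2τ)` are forms of weight `1/2` for `Γ(4)`
    ∃ (h₁ : (fun τ : ℍ => theta ((τ : ℂ) / 4)) ∈ modForms (Gamma 4) 1)
      (h₂ : (fun τ : ℍ => theta (τ : ℂ)) ∈ modForms (Gamma 4) 1)
      (h₃ : (fun τ : ℍ => etaFlat ((τ : ℂ) / 2)) ∈ modForms (Gamma 4) 1)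
      (h₄ : (fun τ : ℍ => etaSharp (2 * (τ : ℂ))) ∈ modForms (Gamma 4) 1)
      -- and `η^6` is a form of weight `3`
      (h₅ : (fun τ : ℍ => ModularForm.eta (τ : ℂ) ^ 6) ∈ modForms (Gamma 4) 6),
      -- the graded ring is the polynomial ring `ℂ[θ(τ/4), θ]`
      (AlgebraicIndependent ℂ ![ModRing.form h₁, ModRing.form h₂] ∧
        Algebra.adjoin ℂ {ModRing.form h₁, ModRing.form h₂} = (⊤ : Subalgebra ℂ (ModRing (Gamma 4)))) ∧
      -- and the polynomial ring `ℂ[η^♭(τ/2), η^♯(2τ)]`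
      (AlgebraicIndependent ℂ ![ModRing.form h₃, ModRing.form h₄] ∧
        Algebra.adjoin ℂ {ModRing.form h₃, ModRing.form h₄} = (⊤ : Subalgebra ℂ (ModRing (Gamma 4)))) ∧
      -- the ideal of cusp forms is the principal ideal generated by `η^6`
      cuspIdeal (Gamma 4) = Ideal.span {ModRing.form h₅} := by
  exact ⟨theta_div_four_mem_modForms, thetaEven_mem_modForms, etaFlat_div_two_mem_modForms,
    etaSharp_two_mul_mem_modForms, etaSix_mem_modForms,
    algebraicIndependent_and_adjoin_eq_top _ _ thetaEven_apply_ne_zero thetaSpace_le_span_theta,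
    algebraicIndependent_and_adjoin_eq_top _ _ etaSharp_two_mul_ne_zero thetaSpace_le_span_eta,
    cuspIdeal_eq_span⟩
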